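/- Veto bargaining with disclosure. Let $0\le\underline\theta\le\overline\theta<\infty$ and $\Theta=[\underline\theta,\overline\theta]$, and let $F$ be a probability measure on $\Theta$ that is absolutely continuous with respect to Lebesgue measure. Let the proposer's utility $u:\mathbb R\to\mathbb R$ be continuous and strictly increasing. For each $\theta\in\Theta$ let the vetoer's utility $v(\cdot,\theta):\mathbb R\to\mathbb R$ be continuous, strictly increasing on $(-\infty,\theta]$, strictly decreasing on $[\theta,\infty)$, and symmetric around $\theta$; let $v(a,\cdot)$ be measurable for every $a$, and let $\theta\mapsto v(0,\theta)$ and $\theta\mapsto v(\theta,\theta)$ be $F$-integrable, so that expected payoffs exist. The status quo is the policy $0$. If the proposer (the receiver) proposes $a\in\mathbb R$ and the vetoer (the sender) has type $\theta$, payoffs are $$u_S(a,\theta)=\max\{v(a,\theta),v(0,\theta)\},\qquad u_R(a,\theta)=(u(a)-u(0))\,\mathbf 1_{a\le 2\theta}.$$ *Achievable payoffs.* For a belief $G$ (a probability measure on $\Theta$) let $a^*(G)=\arg\max_{a\in\mathbb R}\int u_R(a,\theta)\,\mathrm dG(\theta)$. A segmentation is a probability distribution $\sigma$ over beliefs with $\int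 G\,\mathrm d\sigma(G)=F$. A payoff profile $(u_S^*,u_R^*)$ is achievable if, for some segmentation $\sigma$ and some measurable (possibly randomized) rule by which the receiver chooses an action in $a^*(G)$ in $\sigma$-almost every segment $G$, the ex ante expected payoffs of the sender and the receiver are $u_S^*$ and $u_R^*$. *Disclosure game.* The sender observes $\theta\sim F$ and sends a message $m$ from the set $\mathcal M(\theta)$ of all closed sets $m\subseteq\Theta$ with $\theta\in m$; the receiver observes $m$ and chooses $a\in\mathbb R$. An equilibrium consists of a measurable sender strategy $\rho$ (a distribution $\rho(\theta)$ over messages for each $\theta$), a measurable receiver strategy $\tau$ (an action $\tau(m)$ for each nonempty closed $m\subseteq\Theta$) and a measurable belief system $\mu$ (a belief $\mu(m)$ for each such $m$), such that: (a) for every $\theta\in\Theta$ the support of $\rho(\theta)$ is contained in $\arg\max_{m\in\mathcal M(\theta)}u_S(\tau(m),\theta)$; (b) $\tau(m)\in a^*(\mu(m))$ for every $m$; (c) the support of $\mu(m)$ is contained in $m$ for every $m$; (d) $\mu$ is a regular conditional distribution of $\theta$ given $m$ under the joint law of $(\theta,m)$ induced by $F$ and $\rho$. **Claim.** For every achievable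 payoff profile $(u_S^*,u_R^*)$ and every $\varepsilon>0$, there is an equilibrium of the disclosure game whose ex ante expected payoffs $(u_S',u_R')$ satisfy $|u_S'-u_S^*|<\varepsilon$ and $|u_R'-u_R^*|<\varepsilon$. -/

import Mathlib

open MeasureTheory ProbabilityTheory TopologicalSpace

/-- The space of nonempty compact subsets, with the topology of the Hausdorff metric, carries its
Borel sigma-algebra. -/
instance instMeasurableSpaceNonemptyCompacts {X : Type*} [TopologicalSpace X] :
    MeasurableSpace (NonemptyCompacts X) := borel _

instance instBorelSpaceNonemptyCompacts {X : Type*} [TopologicalSpace X] :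
    BorelSpace (NonemptyCompacts X) := ⟨rfl⟩

/-- A disclosure environment: a type space `Θ`, an action space `A`, the prior over types, and the
payoffs `u_S(a, θ)` of the sender and `u_R(a, θ)` of the receiver. -/
structure DisclosureGame (Θ A : Type*) [MeasurableSpace Θ] where
  /-- the prior distribution of the sender's type -/
  prior : ProbabilityMeasure Θ
  /-- the sender's payoff -/
  uS : A → Θ → ℝ
  /-- the receiver's payoff -/
  uR : A → Θ → ℝ

/-- An assessment consists of the strategies of the two players and a belief system. As `Θ` is
compact, a message (a nonempty closed set of types) is an element of `NonemptyCompacts Θ`. -/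
structure Assessment (Θ A : Type*) [MetricSpace Θ] [CompactSpace Θ] [MeasurableSpace Θ]
    [MeasurableSpace A] where
  /-- the sender's (behavioral) strategy: type `θ` draws her message from `sender θ` -/
  sender : Kernel Θ (NonemptyCompacts Θ)
  /-- the receiver's strategy -/
  receiver : NonemptyCompacts Θ → A
  /-- the receiver's belief about the type after each message -/
  belief : Kernel (NonemptyCompacts Θ) Θ
  isMarkovKernel_sender : IsMarkovKernel sender
  measurable_receiver : Measurable receiver
  isMarkovKernel_belief : IsMarkovKernel belief

/-- The tautological kernel that sends a belief `G` to the measure `G` on types. -/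
noncomputable def beliefKernel (Θ : Type*) [MeasurableSpace Θ] :
    Kernel (ProbabilityMeasure Θ) Θ :=
  ⟨fun G => (G : Measure Θ), measurable_subtype_coe⟩

instance instIsMarkovKernelBeliefKernel (Θ : Type*) [MeasurableSpace Θ] :
    IsMarkovKernel (beliefKernel Θ) := ⟨fun G => G.2⟩

/-- A segmentation of the prior `F` is a distribution `σ` over beliefs that averages to `F`. -/
def IsSegmentation {Θ : Type*} [MeasurableSpace Θ] (F : ProbabilityMeasure Θ)
    (σ : ProbabilityMeasure (ProbabilityMeasure Θ)) : Prop :=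
  ∀ B : Set Θ, MeasurableSet B →
    ∫⁻ G, (G : Measure Θ) B ∂(σ : Measure (ProbabilityMeasure Θ)) = (F : Measure Θ) B

namespace DisclosureGame

variable {Θ A : Type*}

/-- `a*(G)`: the receiver's optimal actions given the belief `G`. -/
def bestResponses [MeasurableSpace Θ] (Γ : DisclosureGame Θ A) (G : Measure Θ) : Set A :=
  {a | ∀ a', ∫ θ, Γ.uR a' θ ∂G ≤ ∫ θ, Γ.uR a θ ∂G}

/-- If the pair (action, type) has the law `π`, then the expected payoffs of the sender and of the
receiver exist and are `p.1` and `p.2`. -/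
def HasExpectedPayoffs [MeasurableSpace Θ] [MeasurableSpace A] (Γ : DisclosureGame Θ A)
    (π : Measure (A × Θ)) (p : ℝ × ℝ) : Prop :=
  Integrable (fun x => Γ.uS x.1 x.2) π ∧ Integrable (fun x => Γ.uR x.1 x.2) π ∧
    ∫ x, Γ.uS x.1 x.2 ∂π = p.1 ∧ ∫ x, Γ.uR x.1 x.2 ∂π = p.2

/-- A payoff profile is achievable if some segmentation `σ` of the prior achieves it given that the
receiver best-responds in (almost) every segment. The receiver may randomize over his best
responses: in segment `G` he draws his action from `α G`; a deterministic selection is the case in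
which every `α G` is a point mass. -/
def Achievable [MeasurableSpace Θ] [MeasurableSpace A] (Γ : DisclosureGame Θ A)
    (p : ℝ × ℝ) : Prop :=
  ∃ (σ : ProbabilityMeasure (ProbabilityMeasure Θ)) (α : Kernel (ProbabilityMeasure Θ) A),
    IsMarkovKernel α ∧ IsSegmentation Γ.prior σ ∧
    (∀ᵐ G : ProbabilityMeasure Θ ∂(σ : Measure (ProbabilityMeasure Θ)),
      ∀ᵐ a ∂(α G), a ∈ Γ.bestResponses (G : Measure Θ)) ∧
    Γ.HasExpectedPayoffs ((α ×ₖ beliefKernel Θ) ∘ₘ (σ : Measure (ProbabilityMeasure Θ))) p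

variable [MetricSpace Θ] [CompactSpace Θ] [MeasurableSpace Θ] [MeasurableSpace A]

/-- The messages available to type `θ` (those that contain `θ`) which maximize her payoff among the
messages available to her, given the receiver's strategy `τ`. -/
def optimalMessages (Γ : DisclosureGame Θ A) (τ : NonemptyCompacts Θ → A) (θ : Θ) :
    Set (NonemptyCompacts Θ) :=
  {m | θ ∈ m ∧ ∀ m' : NonemptyCompacts Θ, θ ∈ m' → Γ.uS (τ m') θ ≤ Γ.uS (τ m) θ}

/-- Perfect Bayesian equilibrium of the disclosure game. -/
structure IsEquilibrium (Γ : DisclosureGame Θ A) (e : Assessment Θ A) : Prop where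
  /-- every type of the sender discloses evidence optimally -/
  sender_optimal : ∀ θ, (e.sender θ).support ⊆ Γ.optimalMessages e.receiver θ
  /-- after every message, the receiver's action is optimal given his belief -/
  receiver_optimal : ∀ m, e.receiver m ∈ Γ.bestResponses (e.belief m)
  /-- beliefs respect evidence -/
  belief_support : ∀ m, (e.belief m).support ⊆ (m : Set Θ)
  /-- Bayes' rule: the belief system is a regular conditional probability of the type given the
  message, under the joint law of type and message induced by the prior and the sender's
  strategy -/
  bayes : (e.sender ∘ₘ (Γ.prior : Measure Θ)) ⊗ₘ e.belief =
    ((Γ.prior : Measure Θ) ⊗ₘ e.sender).map Prod.swap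

/-- The assessment `e` yields the ex ante expected payoffs `p`. -/
def Yields (Γ : DisclosureGame Θ A) (e : Assessment Θ A) (p : ℝ × ℝ) : Prop :=
  Γ.HasExpectedPayoffs
    (((Γ.prior : Measure Θ) ⊗ₘ e.sender).map fun x => (e.receiver x.2, x.1)) p

/-- A payoff profile is supportable if it is the ex ante expected payoff of some equilibrium. -/
def Supportable (Γ : DisclosureGame Θ A) (p : ℝ × ℝ) : Prop :=
  ∃ e : Assessment Θ A, Γ.IsEquilibrium e ∧ Γ.Yields e p

end DisclosureGame

/-- A utility function over policies in `ℝ` that is continuous, strictly single-peaked with the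
unique maximizer `θ`, and symmetric around `θ`. -/
structure IsSymmetricSinglePeaked (f : ℝ → ℝ) (θ : ℝ) : Prop where
  continuous : Continuous f
  strictMonoOn : StrictMonoOn f (Set.Iic θ)
  strictAntiOn : StrictAntiOn f (Set.Ici θ)
  symmetric : ∀ t, f (θ + t) = f (θ - t)

/-- Veto bargaining with disclosure. The status quo is the policy `0`. The vetoer (sender), whose
type is her ideal policy, has the utility `v a θ` from policy `a`; the proposer (receiver) has the
utility `u a` and proposes a policy `a ∈ ℝ`. A proposal `a ≥ 0` is accepted if and only if
`a ≤ 2 * θ`; the proposer's payoff is measured relative to the status quo. -/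
noncomputable def vetoGame {lo hi : ℝ} (F : ProbabilityMeasure (Set.Icc lo hi)) (u : ℝ → ℝ)
    (v : ℝ → Set.Icc lo hi → ℝ) : DisclosureGame (Set.Icc lo hi) ℝ where
  prior := F
  uS a θ := max (v a θ) (v 0 θ)
  uR a θ := if a ≤ 2 * (θ : ℝ) then u a - u 0 else 0

/-! An equilibrium can pool the types of finitely many disjoint compact messages of positive
probability. After any other message the proposer is skeptical: he believes in the greatest type in
the message and extracts everything from her, so every type in that message is left with her status
quo payoff. A type in a pooled message belongs to no other pooled message and hence has no better
disclosure; a type in none of them gains nothing whatever she discloses (`supportable_disclose`).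
The task is to find disjoint compact sets on which the proposer's optimal actions nearly reproduce
the given payoffs.

Segmentation and randomization matter only through the joint law of proposal and type. Averaging
best responses shows that no event of recommendations makes a constant nonnegative proposal a
profitable deviation (`exists_isObedientLaw_of_achievable`). Cut the recommendations into short
cells `[b, c)`. By obedience, `b` is nearly optimal against the types in its cell, but a distant
proposal may be just as good, and a small perturbation could then select it. The distribution is
therefore tilted: all mass is scaled down by `1 - δ`, except that of the types in `[b / 2, (b + Δ) /
2)`. These types accept `b` and all lower proposals but reject `b + Δ`, so proposals not close to
`b` become worse by a fixed margin (`exists_pos_gap_tilt`, `exists_margin`).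

The tilted distributions sum to at most the prior. Since the prior has no atoms, disjoint compact
sets `C k` approximate them, uniformly in the demand and for finitely many integrals
(`exists_pairwiseDisjoint_isCompact`). With an error below the margin, every best response on `C k`
is within `Δ` of `b`. The sender's surplus has an integrable modulus of continuity in the proposal
(`exists_integrable_modulus`), so her payoff changes little; the receiver's profit on `C k` is
controlled by obedience. Recommendations below a small `p` lie outside the grid, as the construction
needs `b > 0`. They yield little surplus, and by obedience their types are mostly so low that even
full extraction yields little (`setIntegral_Iio_le`). -/

/-! ### Messages and disclosure rules -/

/-- The largest element of a nonempty compact subset of a linear order. -/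
noncomputable def TopologicalSpace.NonemptyCompacts.greatest {α : Type*} [LinearOrder α]
    [TopologicalSpace α] [ClosedIciTopology α] (m : NonemptyCompacts α) : α :=
  (m.isCompact.exists_isGreatest m.nonempty).choose

theorem TopologicalSpace.NonemptyCompacts.isGreatest_greatest {α : Type*} [LinearOrder α]
    [TopologicalSpace α] [ClosedIciTopology α] (m : NonemptyCompacts α) :
    IsGreatest (m : Set α) m.greatest :=
  (m.isCompact.exists_isGreatest m.nonempty).choose_spec

/-- The greatest element lies below `x` exactly when the whole compact set does, which is an open
condition on compact sets. -/
theorem TopologicalSpace.NonemptyCompacts.measurable_greatest {α : Type*} [LinearOrder α]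
    [TopologicalSpace α] [OrderTopology α] [SecondCountableTopology α] [MeasurableSpace α]
    [BorelSpace α] : Measurable (NonemptyCompacts.greatest : NonemptyCompacts α → α) := by
  refine measurable_of_Iio fun x => ?_
  have : NonemptyCompacts.greatest ⁻¹' Set.Iio x =
      {m : NonemptyCompacts α | (m : Set α) ⊆ Set.Iio x} := by
    ext m
    refine ⟨fun h y hy => (m.isGreatest_greatest.2 hy).trans_lt h,
      fun h => h m.isGreatest_greatest.1⟩
  rw [this]
  exact (NonemptyCompacts.isOpen_subsets_of_isOpen isOpen_Iio).measurableSet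

theorem TopologicalSpace.NonemptyCompacts.greatest_singleton {α : Type*} [LinearOrder α]
    [TopologicalSpace α] [ClosedIciTopology α] (x : α) :
    ({x} : NonemptyCompacts α).greatest = x := by
  have := ({x} : NonemptyCompacts α).isGreatest_greatest.1
  simpa using this

open Classical in
/-- The disclosure rule that discloses the member of `S` to which a type belongs, and discloses
the type itself if there is none. -/
noncomputable def disclose {X : Type*} [TopologicalSpace X] (S : Finset (NonemptyCompacts X))
    (x : X) : NonemptyCompacts X :=
  if h : ∃ m ∈ S, x ∈ m then h.choose else {x}

section disclose

variable {X : Type*} [TopologicalSpace X] {S : Finset (NonemptyCompacts X)}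

theorem mem_disclose (x : X) : x ∈ disclose S x := by
  unfold disclose
  split_ifs with h
  · exact h.choose_spec.2
  · exact (NonemptyCompacts.mem_singleton _ _).2 rfl

theorem disclose_eq_singleton {x : X} (h : ∀ m ∈ S, x ∉ m) : disclose S x = {x} := by
  rw [disclose, dif_neg (by push Not; exact h)]

theorem disclose_notMem {x : X} (h : ∀ m ∈ S, x ∉ m) : disclose S x ∉ S :=
  fun hm => h _ hm (mem_disclose x)

theorem eq_of_mem_of_pairwiseDisjoint
    (hS : (S : Set (NonemptyCompacts X)).PairwiseDisjoint (fun m => (m : Set X)))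
    {m m' : NonemptyCompacts X} (hm : m ∈ S) (hm' : m' ∈ S) {x : X} (hx : x ∈ m) (hx' : x ∈ m') :
    m = m' :=
  hS.elim_set hm hm' x hx hx'

theorem disclose_eq_of_mem
    (hS : (S : Set (NonemptyCompacts X)).PairwiseDisjoint (fun m => (m : Set X)))
    {m : NonemptyCompacts X} (hm : m ∈ S) {x : X} (hx : x ∈ m) : disclose S x = m := by
  have h : ∃ m ∈ S, x ∈ m := ⟨m, hm, hx⟩
  rw [disclose, dif_pos h]
  exact eq_of_mem_of_pairwiseDisjoint hS h.choose_spec.1 hm h.choose_spec.2 hx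

end disclose

/-- The rule is constant on each of the finitely many compact members of `S`, and elsewhere it is
the isometry `x ↦ {x}`. -/
theorem measurable_disclose {X : Type*} [MetricSpace X] [MeasurableSpace X] [BorelSpace X]
    {S : Finset (NonemptyCompacts X)}
    (hS : (S : Set (NonemptyCompacts X)).PairwiseDisjoint (fun m => (m : Set X))) :
    Measurable (disclose S) := by
  intro B hB
  have hU : MeasurableSet (⋃ m ∈ S, (m : Set X)) :=
    Finset.measurableSet_biUnion S fun m _ => m.isCompact.measurableSet
  have hsing : Measurable (fun x : X => ({x} : NonemptyCompacts X)) :=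
    NonemptyCompacts.isometry_singleton.continuous.measurable
  classical
  have : disclose S ⁻¹' B = (⋃ m ∈ S.filter (· ∈ B), (m : Set X)) ∪
      ((fun x : X => ({x} : NonemptyCompacts X)) ⁻¹' B \ ⋃ m ∈ S, (m : Set X)) := by
    ext x
    by_cases h : ∃ m ∈ S, x ∈ m
    · obtain ⟨m, hm, hx⟩ := h
      have h1 : x ∈ ⋃ m ∈ S, (m : Set X) := Set.mem_biUnion hm hx
      simp only [Set.mem_preimage, disclose_eq_of_mem hS hm hx, Set.mem_union, Set.mem_sdiff, h1,
        not_true, and_false, or_false, Set.mem_iUnion, Finset.mem_filter, exists_prop]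
      refine ⟨fun hB => ⟨m, ⟨hm, hB⟩, hx⟩, fun ⟨m', ⟨hm', hB'⟩, hx'⟩ => ?_⟩
      rwa [eq_of_mem_of_pairwiseDisjoint hS hm hm' hx hx']
    · push Not at h
      simp only [Set.mem_preimage, disclose_eq_singleton h, Set.mem_union, Set.mem_sdiff,
        Set.mem_iUnion, Finset.mem_filter, exists_prop]
      constructor
      · intro hB
        exact Or.inr ⟨hB, fun ⟨m, hm, hx⟩ => h m hm hx⟩
      · rintro (⟨m, ⟨hm, -⟩, hx⟩ | h')
        · exact absurd hx (h m hm)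
        · exact h'.1
  rw [this]
  exact (Finset.measurableSet_biUnion _ fun m _ => m.isCompact.measurableSet).union
    ((hsing hB).diff hU)

/-! ### Skeptical beliefs and Bayes' rule -/

open Classical in
/-- The belief system that conditions the prior on the messages in `S` and is skeptical
(concentrated on the greatest type) after all other messages. -/
noncomputable def skepticalBelief {lo hi : ℝ} (F : Measure (Set.Icc lo hi))
    (S : Finset (NonemptyCompacts (Set.Icc lo hi))) :
    Kernel (NonemptyCompacts (Set.Icc lo hi)) (Set.Icc lo hi) where
  toFun m := if m ∈ S then F[|(m : Set (Set.Icc lo hi))] else Measure.dirac m.greatest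
  measurable' := by
    -- The belief differs from the everywhere skeptical one, which is measurable, only at the
    -- finitely many messages in `S`.
    refine (Measure.measurable_dirac.comp
      NonemptyCompacts.measurable_greatest).measurable_of_countable_ne ?_
    refine S.finite_toSet.countable.mono fun m hm => ?_
    by_contra h
    refine hm ?_
    have h' : m ∉ S := h
    simp [h']

theorem skepticalBelief_of_mem {lo hi : ℝ} (F : Measure (Set.Icc lo hi))
    {S : Finset (NonemptyCompacts (Set.Icc lo hi))} {m : NonemptyCompacts (Set.Icc lo hi)}
    (hm : m ∈ S) : skepticalBelief F S m = F[|(m : Set (Set.Icc lo hi))] := if_pos hm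

theorem skepticalBelief_of_notMem {lo hi : ℝ} (F : Measure (Set.Icc lo hi))
    {S : Finset (NonemptyCompacts (Set.Icc lo hi))} {m : NonemptyCompacts (Set.Icc lo hi)}
    (hm : m ∉ S) : skepticalBelief F S m = Measure.dirac m.greatest := if_neg hm

theorem isMarkovKernel_skepticalBelief {lo hi : ℝ} (F : Measure (Set.Icc lo hi))
    [IsFiniteMeasure F] {S : Finset (NonemptyCompacts (Set.Icc lo hi))}
    (hS : ∀ m ∈ S, F (m : Set (Set.Icc lo hi)) ≠ 0) :
    IsMarkovKernel (skepticalBelief F S) := by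
  refine ⟨fun m => ?_⟩
  by_cases h : m ∈ S
  · rw [skepticalBelief_of_mem F h]
    exact cond_isProbabilityMeasure (hS m h)
  · rw [skepticalBelief_of_notMem F h]
    infer_instance

open Classical in
/-- The receiver's strategy that plays `act` after the messages in `S` and the action that extracts
everything from the greatest type after all other messages. -/
noncomputable def skepticalAction {lo hi : ℝ} (S : Finset (NonemptyCompacts (Set.Icc lo hi)))
    (act : NonemptyCompacts (Set.Icc lo hi) → ℝ) (m : NonemptyCompacts (Set.Icc lo hi)) : ℝ :=
  if m ∈ S then act m else 2 * (m.greatest : ℝ)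

theorem measurable_skepticalAction {lo hi : ℝ} (S : Finset (NonemptyCompacts (Set.Icc lo hi)))
    (act : NonemptyCompacts (Set.Icc lo hi) → ℝ) : Measurable (skepticalAction S act) := by
  have h : Measurable fun m : NonemptyCompacts (Set.Icc lo hi) => 2 * (m.greatest : ℝ) :=
    (measurable_subtype_coe.comp NonemptyCompacts.measurable_greatest).const_mul 2
  refine h.measurable_of_countable_ne (S.finite_toSet.countable.mono fun m hm => ?_)
  by_contra h
  have h' : m ∉ S := h
  exact hm (by simp [skepticalAction, h'])

/-- Bayes' rule holds when every type discloses her member of `S`, or herself. -/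
theorem bayes_disclose {lo hi : ℝ} (F : Measure (Set.Icc lo hi)) [IsProbabilityMeasure F]
    {S : Finset (NonemptyCompacts (Set.Icc lo hi))}
    (hS : (S : Set (NonemptyCompacts (Set.Icc lo hi))).PairwiseDisjoint
      (fun m => (m : Set (Set.Icc lo hi))))
    (hpos : ∀ m ∈ S, F (m : Set (Set.Icc lo hi)) ≠ 0) :
    (Kernel.deterministic (disclose S) (measurable_disclose hS) ∘ₘ F) ⊗ₘ skepticalBelief F S =
      (F ⊗ₘ Kernel.deterministic (disclose S) (measurable_disclose hS)).map Prod.swap := by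
  have hf := measurable_disclose hS
  have := isMarkovKernel_skepticalBelief F hpos
  have hU : MeasurableSet (⋃ m ∈ S, (m : Set (Set.Icc lo hi))) :=
    Finset.measurableSet_biUnion S fun m _ => m.isCompact.measurableSet
  rw [Measure.deterministic_comp_eq_map, Measure.compProd_deterministic,
    Measure.map_map measurable_swap (by fun_prop)]
  ext E hE
  have hg : Measurable fun x => skepticalBelief F S x (Prod.mk x ⁻¹' E) :=
    Kernel.measurable_kernel_prodMk_left hE
  have hmeas : Measurable fun a => (disclose S a, a) := hf.prodMk measurable_id
  rw [Measure.compProd_apply hE, lintegral_map hg hf, Measure.map_apply (by exact hmeas) hE,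
    ← lintegral_indicator_one (by exact hmeas hE), ← lintegral_add_compl _ hU,
    ← lintegral_add_compl (Set.indicator _ _) hU, lintegral_biUnion_finset hS
      (fun m _ => m.isCompact.measurableSet), lintegral_biUnion_finset hS
      (fun m _ => m.isCompact.measurableSet)]
  congr 1
  -- On a pooled message the conditional probability is constant, and multiplication by the mass of
  -- the message undoes the normalization.
  · refine Finset.sum_congr rfl fun m hm => ?_
    have hmm : MeasurableSet (m : Set (Set.Icc lo hi)) := m.isCompact.measurableSet
    have hEm : MeasurableSet (Prod.mk m ⁻¹' E) := measurable_prodMk_left hE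
    have h1 : ∫⁻ x in (m : Set (Set.Icc lo hi)),
        skepticalBelief F S (disclose S x) (Prod.mk (disclose S x) ⁻¹' E) ∂F =
        ∫⁻ _ in (m : Set (Set.Icc lo hi)), F[|(m : Set (Set.Icc lo hi))] (Prod.mk m ⁻¹' E) ∂F :=
      setLIntegral_congr_fun hmm fun x hx => by
        simp only [disclose_eq_of_mem hS hm hx, skepticalBelief_of_mem F hm]
    have h2 : ∫⁻ x in (m : Set (Set.Icc lo hi)),
        ((Prod.swap ∘ fun a => (a, disclose S a)) ⁻¹' E).indicator 1 x ∂F =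
        ∫⁻ x in (m : Set (Set.Icc lo hi)), (Prod.mk m ⁻¹' E).indicator 1 x ∂F :=
      setLIntegral_congr_fun hmm fun x hx => by
        refine Set.indicator_const_eq_indicator_const ?_
        simp only [Set.mem_preimage, Function.comp_apply, Prod.swap_prod_mk,
          disclose_eq_of_mem hS hm hx]
    rw [h1, h2, setLIntegral_const, lintegral_indicator_one hEm, Measure.restrict_apply hEm,
      cond_apply hmm, mul_comm, ← mul_assoc, ENNReal.mul_inv_cancel (hpos m hm) (measure_ne_top _ _),
      one_mul, Set.inter_comm]
  -- Elsewhere the message is `{x}`, whose greatest element is `x`, so the skeptical belief is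
  -- correct.
  · refine setLIntegral_congr_fun hU.compl fun x hx => ?_
    have hx' : ∀ m ∈ S, x ∉ m := fun m hm hxm => hx (Set.mem_biUnion hm hxm)
    have hd : disclose S x ∉ S := disclose_notMem hx'
    simp only [skepticalBelief_of_notMem F hd]
    rw [disclose_eq_singleton hx', NonemptyCompacts.greatest_singleton,
      Measure.dirac_apply' _ (measurable_prodMk_left hE)]
    refine Set.indicator_const_eq_indicator_const ?_
    simp only [Set.mem_preimage, Function.comp_apply, Prod.swap_prod_mk,
      disclose_eq_singleton hx']

/-! ### Payoffs relative to the status quo -/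

namespace IsSymmetricSinglePeaked

variable {f : ℝ → ℝ} {θ : ℝ}

theorem le_peak (h : IsSymmetricSinglePeaked f θ) (a : ℝ) : f a ≤ f θ := by
  rcases le_total a θ with ha | ha
  · exact h.strictMonoOn.monotoneOn ha (Set.mem_Iic.2 le_rfl) ha
  · exact h.strictAntiOn.antitoneOn (Set.mem_Ici.2 le_rfl) ha ha

theorem two_mul_eq_zero (h : IsSymmetricSinglePeaked f θ) : f (2 * θ) = f 0 := by
  have := h.symmetric θ
  rwa [← two_mul, sub_self] at this

theorem le_statusQuo_of_two_mul_le (h : IsSymmetricSinglePeaked f θ) (hθ : 0 ≤ θ) {a : ℝ}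
    (ha : 2 * θ ≤ a) : f a ≤ f 0 := by
  rw [← h.two_mul_eq_zero]
  exact h.strictAntiOn.antitoneOn (Set.mem_Ici.2 (by linarith)) (Set.mem_Ici.2 (by linarith)) ha

theorem le_statusQuo_of_nonpos (h : IsSymmetricSinglePeaked f θ) (hθ : 0 ≤ θ) {a : ℝ}
    (ha : a ≤ 0) : f a ≤ f 0 :=
  h.strictMonoOn.monotoneOn (Set.mem_Iic.2 (by linarith)) (Set.mem_Iic.2 hθ) ha

end IsSymmetricSinglePeaked

/-- The sender's gain over the status quo from the proposal `a`. -/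
noncomputable def vetoSurplus {lo hi : ℝ} (v : ℝ → Set.Icc lo hi → ℝ) (a : ℝ)
    (θ : Set.Icc lo hi) : ℝ :=
  max (v a θ) (v 0 θ) - v 0 θ

/-- The receiver's payoff from the proposal `a`. -/
noncomputable def vetoProfit {lo hi : ℝ} (u : ℝ → ℝ) (a : ℝ) (θ : Set.Icc lo hi) : ℝ :=
  if a ≤ 2 * (θ : ℝ) then u a - u 0 else 0

section VetoPayoffs

variable {lo hi : ℝ} {u : ℝ → ℝ} {v : ℝ → Set.Icc lo hi → ℝ}

theorem vetoGame_uS (F : ProbabilityMeasure (Set.Icc lo hi)) (a : ℝ) (θ : Set.Icc lo hi) :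
    (vetoGame F u v).uS a θ = v 0 θ + vetoSurplus v a θ := by
  simp [vetoGame, vetoSurplus]

theorem vetoGame_uR (F : ProbabilityMeasure (Set.Icc lo hi)) (a : ℝ) (θ : Set.Icc lo hi) :
    (vetoGame F u v).uR a θ = vetoProfit u a θ := rfl

theorem vetoSurplus_nonneg (a : ℝ) (θ : Set.Icc lo hi) : 0 ≤ vetoSurplus v a θ := by
  simp [vetoSurplus]

theorem vetoSurplus_zero (θ : Set.Icc lo hi) : vetoSurplus v 0 θ = 0 := by
  simp [vetoSurplus]

/-- The bound does not depend on the proposal, so the surpluses from all proposals share one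
integrable majorant. -/
theorem vetoSurplus_le
    (hv : ∀ θ : Set.Icc lo hi, IsSymmetricSinglePeaked (fun a => v a θ) (θ : ℝ))
    (a : ℝ) (θ : Set.Icc lo hi) : vetoSurplus v a θ ≤ v θ θ - v 0 θ :=
  sub_le_sub_right (max_le ((hv θ).le_peak a) ((hv θ).le_peak 0)) _

theorem vetoSurplus_eq_zero_of_two_mul_le (hlo : 0 ≤ lo)
    (hv : ∀ θ : Set.Icc lo hi, IsSymmetricSinglePeaked (fun a => v a θ) (θ : ℝ))
    {a : ℝ} {θ : Set.Icc lo hi} (ha : 2 * (θ : ℝ) ≤ a) : vetoSurplus v a θ = 0 := by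
  rw [vetoSurplus, max_eq_right ((hv θ).le_statusQuo_of_two_mul_le (hlo.trans θ.2.1) ha), sub_self]

theorem vetoSurplus_eq_zero_of_nonpos (hlo : 0 ≤ lo)
    (hv : ∀ θ : Set.Icc lo hi, IsSymmetricSinglePeaked (fun a => v a θ) (θ : ℝ))
    {a : ℝ} {θ : Set.Icc lo hi} (ha : a ≤ 0) : vetoSurplus v a θ = 0 := by
  rw [vetoSurplus, max_eq_right ((hv θ).le_statusQuo_of_nonpos (hlo.trans θ.2.1) ha), sub_self]

theorem continuous_vetoSurplus
    (hv : ∀ θ : Set.Icc lo hi, IsSymmetricSinglePeaked (fun a => v a θ) (θ : ℝ))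
    (θ : Set.Icc lo hi) : Continuous fun a => vetoSurplus v a θ :=
  ((hv θ).continuous.max continuous_const).sub continuous_const

theorem measurable_vetoSurplus (hv_meas : ∀ a : ℝ, Measurable (v a)) (a : ℝ) :
    Measurable (vetoSurplus v a) :=
  ((hv_meas a).max (hv_meas 0)).sub (hv_meas 0)

theorem measurable_uncurry_vetoSurplus
    (hv : ∀ θ : Set.Icc lo hi, IsSymmetricSinglePeaked (fun a => v a θ) (θ : ℝ))
    (hv_meas : ∀ a : ℝ, Measurable (v a)) :
    Measurable fun x : ℝ × Set.Icc lo hi => vetoSurplus v x.1 x.2 :=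
  measurable_uncurry_of_continuous_of_measurable (u := vetoSurplus v)
    (continuous_vetoSurplus hv) (measurable_vetoSurplus hv_meas)

theorem measurable_uncurry_vetoProfit (hu : Continuous u) :
    Measurable fun x : ℝ × Set.Icc lo hi => vetoProfit u x.1 x.2 := by
  refine Measurable.ite (measurableSet_le (by fun_prop) (by fun_prop)) ?_ measurable_const
  exact (hu.measurable.comp measurable_fst).sub_const _

theorem measurable_vetoProfit (u : ℝ → ℝ) (a : ℝ) :
    Measurable fun θ : Set.Icc lo hi => vetoProfit u a θ :=
  Measurable.ite (measurableSet_le (by fun_prop) (by fun_prop)) measurable_const measurable_const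

theorem abs_vetoProfit_le (a : ℝ) (θ : Set.Icc lo hi) : |vetoProfit u a θ| ≤ |u a - u 0| := by
  unfold vetoProfit
  split_ifs <;> simp

theorem vetoProfit_two_mul (θ : Set.Icc lo hi) :
    vetoProfit u (2 * (θ : ℝ)) θ = u (2 * θ) - u 0 := if_pos le_rfl

theorem vetoProfit_le (hu : StrictMono u) (hlo : 0 ≤ lo) (a : ℝ) (θ : Set.Icc lo hi) :
    vetoProfit u a θ ≤ u (2 * θ) - u 0 := by
  have h0 : (0 : ℝ) ≤ θ := hlo.trans θ.2.1
  unfold vetoProfit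
  split_ifs with h
  · exact sub_le_sub_right (hu.monotone h) _
  · exact sub_nonneg.2 (hu.monotone (by linarith))

variable {μ : Measure (Set.Icc lo hi)}

theorem integrable_vetoSurplus
    (hv : ∀ θ : Set.Icc lo hi, IsSymmetricSinglePeaked (fun a => v a θ) (θ : ℝ))
    (hv_meas : ∀ a : ℝ, Measurable (v a))
    (hv_int_statusQuo : Integrable (fun θ : Set.Icc lo hi => v 0 θ) μ)
    (hv_int_ideal : Integrable (fun θ : Set.Icc lo hi => v (θ : ℝ) θ) μ) (a : ℝ) :
    Integrable (vetoSurplus v a) μ :=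
  (hv_int_ideal.sub hv_int_statusQuo).mono' (measurable_vetoSurplus hv_meas a).aestronglyMeasurable
    (.of_forall fun θ => by
      rw [Real.norm_of_nonneg (vetoSurplus_nonneg a θ)]
      exact vetoSurplus_le hv a θ)

theorem integrable_vetoProfit [IsFiniteMeasure μ] (u : ℝ → ℝ) (a : ℝ) :
    Integrable (fun θ => vetoProfit u a θ) μ :=
  (integrable_const |u a - u 0|).mono' (measurable_vetoProfit u a).aestronglyMeasurable
    (.of_forall fun θ => abs_vetoProfit_le a θ)

theorem integrable_fullProfit [IsFiniteMeasure μ] (hu : StrictMono u) (hu_cont : Continuous u) :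
    Integrable (fun θ : Set.Icc lo hi => u (2 * θ) - u 0) μ := by
  refine (integrable_const (max |u (2 * lo) - u 0| |u (2 * hi) - u 0|)).mono'
    (by fun_prop) (.of_forall fun θ => ?_)
  refine abs_le_max_abs_abs ?_ ?_ <;> refine sub_le_sub_right (hu.monotone ?_) _
  · linarith [θ.2.1]
  · linarith [θ.2.2]

end VetoPayoffs

/-! ### Equilibria with finitely many pools -/

/-- If the members of a finite family of disjoint messages have positive probability, then it is an
equilibrium that the types in these messages pool on them, that the receiver takes an optimal action
given the conditional distribution, and that all other types disclose themselves. -/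
theorem supportable_disclose {lo hi : ℝ} (hlo : 0 ≤ lo) (F : ProbabilityMeasure (Set.Icc lo hi))
    {u : ℝ → ℝ} (hu : StrictMono u) (hu_cont : Continuous u) {v : ℝ → Set.Icc lo hi → ℝ}
    (hv : ∀ θ : Set.Icc lo hi, IsSymmetricSinglePeaked (fun a => v a θ) (θ : ℝ))
    (hv_meas : ∀ a : ℝ, Measurable (v a))
    (hv_int_statusQuo : Integrable (fun θ : Set.Icc lo hi => v 0 θ) (F : Measure (Set.Icc lo hi)))
    (hv_int_ideal : Integrable (fun θ : Set.Icc lo hi => v (θ : ℝ) θ) (F : Measure (Set.Icc lo hi)))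
    {S : Finset (NonemptyCompacts (Set.Icc lo hi))}
    (hS : (S : Set (NonemptyCompacts (Set.Icc lo hi))).PairwiseDisjoint
      (fun m => (m : Set (Set.Icc lo hi))))
    (hpos : ∀ m ∈ S, (F : Measure (Set.Icc lo hi)) (m : Set (Set.Icc lo hi)) ≠ 0)
    {act : NonemptyCompacts (Set.Icc lo hi) → ℝ}
    (hact : ∀ m ∈ S, act m ∈ (vetoGame F u v).bestResponses
      (F : Measure (Set.Icc lo hi))[|(m : Set (Set.Icc lo hi))]) :
    (vetoGame F u v).Supportable
      (∫ θ, v 0 θ ∂(F : Measure (Set.Icc lo hi)) + ∑ m ∈ S, ∫ θ in (m : Set (Set.Icc lo hi)),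
          vetoSurplus v (act m) θ ∂(F : Measure (Set.Icc lo hi)),
        ∫ θ, (u (2 * θ) - u 0) ∂(F : Measure (Set.Icc lo hi)) +
          ∑ m ∈ S, ∫ θ in (m : Set (Set.Icc lo hi)),
            (vetoProfit u (act m) θ - (u (2 * θ) - u 0)) ∂(F : Measure (Set.Icc lo hi))) := by
  have hf := measurable_disclose hS
  have hmeas (m : NonemptyCompacts (Set.Icc lo hi)) : MeasurableSet (m : Set (Set.Icc lo hi)) :=
    m.isCompact.measurableSet
  have hτ := measurable_skepticalAction S act
  -- Skepticism proposes `2 * m.greatest ≥ 2 * θ`, at or beyond the point of indifference of every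
  -- type in `m`.
  have hzero {m : NonemptyCompacts (Set.Icc lo hi)} (hm : m ∉ S) {θ : Set.Icc lo hi} (hθ : θ ∈ m) :
      vetoSurplus v (skepticalAction S act m) θ = 0 := by
    refine vetoSurplus_eq_zero_of_two_mul_le hlo hv ?_
    rw [skepticalAction, if_neg hm]
    have : (θ : ℝ) ≤ m.greatest := m.isGreatest_greatest.2 hθ
    linarith
  -- Both payoffs have this form: a baseline `c` from full disclosure and a correction `g m` on each
  -- pooled message.
  have hsum (g : NonemptyCompacts (Set.Icc lo hi) → Set.Icc lo hi → ℝ) (c : Set.Icc lo hi → ℝ)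
      (k : Set.Icc lo hi → ℝ) (hin : ∀ m ∈ S, ∀ θ ∈ m, k θ = c θ + g m θ)
      (hout : ∀ θ, (∀ m ∈ S, θ ∉ m) → k θ = c θ) (hc : Integrable c (F : Measure (Set.Icc lo hi)))
      (hg : ∀ m ∈ S, Integrable (g m) (F : Measure (Set.Icc lo hi))) :
      Integrable k (F : Measure (Set.Icc lo hi)) ∧ ∫ θ, k θ ∂(F : Measure (Set.Icc lo hi)) =
        ∫ θ, c θ ∂(F : Measure (Set.Icc lo hi)) + ∑ m ∈ S, ∫ θ in (m : Set (Set.Icc lo hi)),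
          g m θ ∂(F : Measure (Set.Icc lo hi)) := by
    have hk : k = fun θ => c θ + ∑ m ∈ S, (m : Set (Set.Icc lo hi)).indicator (g m) θ := by
      ext θ
      by_cases h : ∃ m ∈ S, θ ∈ m
      · obtain ⟨m, hm, hθ⟩ := h
        rw [hin m hm θ hθ, Finset.sum_eq_single_of_mem m hm, Set.indicator_of_mem hθ]
        intro m' hm' hne
        refine Set.indicator_of_notMem (fun hθ' => hne ?_) _
        exact eq_of_mem_of_pairwiseDisjoint hS hm' hm hθ' hθ
      · push Not at h
        rw [hout θ h, Finset.sum_eq_zero, add_zero]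
        exact fun m hm => Set.indicator_of_notMem (h m hm) _
    have hi (m) (hm : m ∈ S) : Integrable ((m : Set (Set.Icc lo hi)).indicator (g m))
        (F : Measure (Set.Icc lo hi)) := (hg m hm).indicator (hmeas m)
    rw [hk]
    refine ⟨hc.add (integrable_finsetSum _ hi), ?_⟩
    rw [integral_add hc (integrable_finsetSum _ hi), integral_finsetSum _ hi]
    simp only [integral_indicator (hmeas _)]
  have hMarkov := isMarkovKernel_skepticalBelief (F : Measure (Set.Icc lo hi)) hpos
  refine ⟨⟨Kernel.deterministic (disclose S) hf, skepticalAction S act,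
    skepticalBelief (F : Measure (Set.Icc lo hi)) S, inferInstance, hτ, hMarkov⟩,
    ⟨?_, ?_, ?_, bayes_disclose _ hS hpos⟩, ?_⟩
  · intro θ
    have hopt : disclose S θ ∈ (vetoGame F u v).optimalMessages (skepticalAction S act) θ := by
      refine ⟨mem_disclose θ, fun m' hm' => ?_⟩
      rw [vetoGame_uS, vetoGame_uS]
      -- By disjointness the prescribed message is the only member of `S` that contains `θ`; all
      -- messages outside `S` yield no surplus.
      by_cases h : m' ∈ S
      · rw [disclose_eq_of_mem hS h hm']
      · rw [hzero h hm']
        exact add_le_add_right (vetoSurplus_nonneg _ _) _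
    refine (Measure.support_subset_of_isClosed (isClosed_singleton (x := disclose S θ)) ?_).trans
      (Set.singleton_subset_iff.2 hopt)
    rw [Kernel.deterministic_apply, mem_ae_dirac_iff (measurableSet_singleton _)]
    exact Set.mem_singleton _
  · intro m
    by_cases hm : m ∈ S
    · simp only [skepticalAction, if_pos hm, skepticalBelief_of_mem _ hm]
      exact hact m hm
    · simp only [skepticalAction, if_neg hm, skepticalBelief_of_notMem _ hm]
      intro a
      rw [integral_dirac, integral_dirac, vetoGame_uR, vetoGame_uR, vetoProfit_two_mul]
      exact vetoProfit_le hu hlo a _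
  · intro m
    refine Measure.support_subset_of_isClosed m.isCompact.isClosed ?_
    by_cases hm : m ∈ S
    · simp only [skepticalBelief_of_mem _ hm]
      exact ae_cond_mem (hmeas m)
    · simp only [skepticalBelief_of_notMem _ hm]
      rw [mem_ae_dirac_iff (hmeas m)]
      exact m.isGreatest_greatest.1
  · have hprior : ((vetoGame F u v).prior : Measure (Set.Icc lo hi)) = F := rfl
    have hpair : Measurable fun θ => (skepticalAction S act (disclose S θ), θ) :=
      (hτ.comp hf).prodMk measurable_id
    have hlaw : (((vetoGame F u v).prior : Measure (Set.Icc lo hi)) ⊗ₘ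
        Kernel.deterministic (disclose S) hf).map (fun x => (skepticalAction S act x.2, x.1)) =
        (F : Measure (Set.Icc lo hi)).map fun θ => (skepticalAction S act (disclose S θ), θ) := by
      rw [hprior, Measure.compProd_deterministic, Measure.map_map _ (by fun_prop)]
      · rfl
      · exact (hτ.comp measurable_snd).prodMk measurable_fst
    have hS_meas : Measurable fun x : ℝ × Set.Icc lo hi => (vetoGame F u v).uS x.1 x.2 := by
      simp only [vetoGame_uS]
      exact ((hv_meas 0).comp measurable_snd).add (measurable_uncurry_vetoSurplus hv hv_meas)
    have hR_meas : Measurable fun x : ℝ × Set.Icc lo hi => (vetoGame F u v).uR x.1 x.2 :=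
      measurable_uncurry_vetoProfit hu_cont
    have key1 := hsum (fun m => vetoSurplus v (act m)) (v 0)
      (fun θ => (vetoGame F u v).uS (skepticalAction S act (disclose S θ)) θ) ?_ ?_
      hv_int_statusQuo (fun m _ => integrable_vetoSurplus hv hv_meas hv_int_statusQuo
        hv_int_ideal (act m))
    have key2 := hsum (fun m θ => vetoProfit u (act m) θ - (u (2 * θ) - u 0))
      (fun θ => u (2 * θ) - u 0)
      (fun θ => (vetoGame F u v).uR (skepticalAction S act (disclose S θ)) θ) ?_ ?_
      (integrable_fullProfit hu hu_cont) (fun m _ => (integrable_vetoProfit u (act m)).sub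
        (integrable_fullProfit hu hu_cont))
    · unfold DisclosureGame.Yields DisclosureGame.HasExpectedPayoffs
      simp only [hlaw]
      refine ⟨(integrable_map_measure hS_meas.aestronglyMeasurable hpair.aemeasurable).2 key1.1,
        (integrable_map_measure hR_meas.aestronglyMeasurable hpair.aemeasurable).2 key2.1, ?_, ?_⟩
      · rw [integral_map hpair.aemeasurable hS_meas.aestronglyMeasurable]
        exact key1.2
      · rw [integral_map hpair.aemeasurable hR_meas.aestronglyMeasurable]
        exact key2.2
    · intro m hm θ hθ
      rw [disclose_eq_of_mem hS hm hθ, skepticalAction, if_pos hm, vetoGame_uR]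
      ring
    · intro θ hθ
      rw [disclose_eq_singleton hθ, skepticalAction, if_neg, NonemptyCompacts.greatest_singleton,
        vetoGame_uR, vetoProfit_two_mul]
      rw [← disclose_eq_singleton hθ]
      exact disclose_notMem hθ
    · intro m hm θ hθ
      rw [disclose_eq_of_mem hS hm hθ, skepticalAction, if_pos hm, vetoGame_uS]
    · intro θ hθ
      rw [vetoGame_uS, hzero (disclose_notMem hθ) (mem_disclose θ), add_zero]

/-! ### Splitting an atomless prior -/

/-- Short intervals are uniformly small under a finite measure that is absolutely continuous with
respect to Lebesgue measure. -/
theorem exists_pos_forall_measureReal_le {lo hi : ℝ} (F : Measure (Set.Icc lo hi))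
    [IsFiniteMeasure F] (hF : F.map (fun θ : Set.Icc lo hi => (θ : ℝ)) ≪ volume) {η : ℝ}
    (hη : 0 < η) : ∃ κ > 0, ∀ x : ℝ, F.real {θ : Set.Icc lo hi | |(θ : ℝ) - x| ≤ κ} ≤ η := by
  set P : Measure ℝ := F.map (fun θ : Set.Icc lo hi => (θ : ℝ)) with hP
  have : IsFiniteMeasure P := Measure.isFiniteMeasure_map _ _
  -- Absolute continuity of the integral of the Lebesgue density, applied below to intervals of
  -- length `2 * κ`.
  obtain ⟨δ, hδ, h⟩ := exists_pos_setLIntegral_lt_of_measure_lt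
    (Measure.lintegral_rnDeriv_lt_top P volume).ne (ENNReal.ofReal_pos.2 hη).ne'
  obtain ⟨κ, hκ, hκδ⟩ : ∃ κ : ℝ, 0 < κ ∧ ENNReal.ofReal (2 * κ) < δ := by
    rcases eq_or_ne δ ⊤ with rfl | hδ'
    · exact ⟨1, one_pos, ENNReal.ofReal_lt_top⟩
    · refine ⟨δ.toReal / 4, div_pos (ENNReal.toReal_pos hδ.ne' hδ') (by norm_num), ?_⟩
      rw [ENNReal.ofReal_lt_iff_lt_toReal _ hδ'] <;> linarith [ENNReal.toReal_pos hδ.ne' hδ']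
  refine ⟨κ, hκ, fun x => ?_⟩
  have hs : {θ : Set.Icc lo hi | |(θ : ℝ) - x| ≤ κ} =
      (fun θ : Set.Icc lo hi => (θ : ℝ)) ⁻¹' Metric.closedBall x κ := by
    ext θ; simp [Metric.mem_closedBall, Real.dist_eq]
  have hlt := h (Metric.closedBall x κ) (by rwa [Real.volume_closedBall])
  rw [Measure.setLIntegral_rnDeriv hF, hP, Measure.map_apply measurable_subtype_coe
    Metric.isClosed_closedBall.measurableSet, ← hs] at hlt
  exact ENNReal.toReal_le_of_le_ofReal hη.le hlt.le

section Splitting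

variable {lo hi : ℝ} {F : Measure (Set.Icc lo hi)} [IsFiniteMeasure F]

/-- Moving the threshold from `a` to `b` only adds types within `|b - a|` of `a`, and such strips
are uniformly small. -/
theorem continuous_measureReal_inter_le
    (hF : ∀ η > 0, ∃ κ > 0, ∀ x : ℝ, F.real {θ : Set.Icc lo hi | |(θ : ℝ) - x| ≤ κ} ≤ η)
    (J : Set (Set.Icc lo hi)) : Continuous fun x : ℝ => F.real (J ∩ {θ | (θ : ℝ) ≤ x}) := by
  rw [Metric.continuous_iff]
  intro x η hη
  obtain ⟨κ, hκ, h⟩ := hF (η / 2) (by linarith)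
  refine ⟨κ, hκ, fun y hy => ?_⟩
  rw [Real.dist_eq, abs_lt] at *
  have key (a b : ℝ) (hab : |b - a| ≤ κ) :
      F.real (J ∩ {θ | (θ : ℝ) ≤ b}) ≤ F.real (J ∩ {θ | (θ : ℝ) ≤ a}) + η / 2 := by
    refine (measureReal_mono (s₂ := J ∩ {θ | (θ : ℝ) ≤ a} ∪ {θ | |(θ : ℝ) - a| ≤ κ}) ?_).trans
      ((measureReal_union_le _ _).trans (add_le_add_right (h a) _))
    rintro θ ⟨hJ, hθ⟩
    rcases le_total (θ : ℝ) a with ha | ha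
    · exact Or.inl ⟨hJ, ha⟩
    · refine Or.inr ?_
      have : (θ : ℝ) ≤ b := hθ
      rw [Set.mem_ofPred_eq, abs_of_nonneg (by linarith)]
      linarith [(abs_le.1 hab).2]
  have h1 := key x y (abs_le.2 ⟨hy.1.le, hy.2.le⟩)
  have h2 := key y x (abs_le.2 ⟨by linarith, by linarith⟩)
  constructor <;> linarith

/-- The mass of the part of `J` below a threshold rises continuously from `0` to `F J`, so a
suitable threshold exists by the intermediate value theorem. -/
theorem exists_subset_measure_eq
    (hF : ∀ η > 0, ∃ κ > 0, ∀ x : ℝ, F.real {θ : Set.Icc lo hi | |(θ : ℝ) - x| ≤ κ} ≤ η)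
    {J : Set (Set.Icc lo hi)} (hJ : MeasurableSet J) {t : ENNReal} (ht : t ≤ F J) :
    ∃ B ⊆ J, MeasurableSet B ∧ F B = t := by
  have htop : t ≠ ⊤ := ne_top_of_le_ne_top (measure_ne_top _ _) ht
  rcases le_or_gt lo hi with hle | hlt
  swap
  · have : IsEmpty (Set.Icc lo hi) := ⟨fun θ => absurd (θ.2.1.trans θ.2.2) (not_le.2 hlt)⟩
    refine ⟨J, subset_rfl, hJ, ?_⟩
    have : F J = 0 := by rw [Set.eq_empty_of_isEmpty J, measure_empty]
    rw [this] at ht ⊢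
    exact (le_zero_iff.1 ht).symm
  -- The range starts at `lo - 1`, where the part below the threshold is empty.
  · have hiv := intermediate_value_Icc (show lo - 1 ≤ hi by linarith)
      (continuous_measureReal_inter_le hF J).continuousOn
    have h0 : F.real (J ∩ {θ | (θ : ℝ) ≤ lo - 1}) = 0 := by
      have : J ∩ {θ | (θ : ℝ) ≤ lo - 1} = ∅ := by
        ext θ
        simp only [Set.mem_inter_iff, Set.mem_ofPred_eq, Set.mem_empty_iff_false, iff_false]
        rintro ⟨-, h⟩
        linarith [θ.2.1]
      rw [this, measureReal_empty]
    have h1 : F.real (J ∩ {θ | (θ : ℝ) ≤ hi}) = F.real J := by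
      congr 1
      ext θ
      simp [θ.2.2]
    obtain ⟨x, -, hx⟩ := hiv (show t.toReal ∈ _ from
      ⟨by rw [h0]; positivity, by rw [h1]; exact ENNReal.toReal_mono (measure_ne_top _ _) ht⟩)
    refine ⟨J ∩ {θ | (θ : ℝ) ≤ x}, Set.inter_subset_left,
      hJ.inter (measurableSet_le measurable_subtype_coe measurable_const), ?_⟩
    exact (ENNReal.toReal_eq_toReal_iff' (measure_ne_top _ _) htop).1 hx

/-- Induction on the family: the next set is carved out of what the previous ones leave of `J`,
which suffices because the prescribed masses sum to at most `F J`. -/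
theorem exists_pairwiseDisjoint_measure_eq {ι : Type*}
    (hF : ∀ η > 0, ∃ κ > 0, ∀ x : ℝ, F.real {θ : Set.Icc lo hi | |(θ : ℝ) - x| ≤ κ} ≤ η)
    {J : Set (Set.Icc lo hi)} (hJ : MeasurableSet J) (K : Finset ι) {t : ι → ENNReal}
    (ht : ∑ k ∈ K, t k ≤ F J) :
    ∃ B : ι → Set (Set.Icc lo hi), (K : Set ι).PairwiseDisjoint B ∧
      ∀ k ∈ K, B k ⊆ J ∧ MeasurableSet (B k) ∧ F (B k) = t k := by
  classical
  induction K using Finset.induction_on with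
  | empty => exact ⟨fun _ => ∅, by simp, by simp⟩
  | insert k K hk ih =>
    rw [Finset.sum_insert hk] at ht
    obtain ⟨B, hdisj, hB⟩ := ih (le_add_self.trans ht)
    have hU : MeasurableSet (⋃ i ∈ K, B i) := Finset.measurableSet_biUnion K fun i hi => (hB i hi).2.1
    have hUJ : (⋃ i ∈ K, B i) ⊆ J := Set.iUnion₂_subset fun i hi => (hB i hi).1
    have hFU : F (⋃ i ∈ K, B i) = ∑ i ∈ K, t i := by
      rw [measure_biUnion_finset hdisj fun i hi => (hB i hi).2.1]
      exact Finset.sum_congr rfl fun i hi => (hB i hi).2.2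
    obtain ⟨B', hB'J, hB'm, hB't⟩ := exists_subset_measure_eq hF (hJ.diff hU) (t := t k) (by
      rw [measure_sdiff hUJ hU.nullMeasurableSet (measure_ne_top _ _), hFU]
      exact ENNReal.le_sub_of_add_le_right (hFU ▸ measure_ne_top _ _) ht)
    have hne {i : ι} (hi : i ∈ K) : i ≠ k := fun h => hk (h ▸ hi)
    refine ⟨Function.update B k B', ?_, fun i hi => ?_⟩
    · rw [Finset.coe_insert, Set.pairwiseDisjoint_insert_of_notMem (by exact_mod_cast hk)]
      refine ⟨fun i hi j hj hij => ?_, fun i hi => ?_⟩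
      · rw [Function.onFun, Function.update_of_ne (hne hi), Function.update_of_ne (hne hj)]
        exact hdisj hi hj hij
      · rw [Function.update_self, Function.update_of_ne (hne hi)]
        refine Set.disjoint_of_subset_left hB'J ?_
        exact Set.disjoint_sdiff_left.mono_right (Set.subset_biUnion_of_mem (u := B) hi)
    · rcases Finset.mem_insert.1 hi with rfl | hi
      · rw [Function.update_self]
        exact ⟨hB'J.trans Set.sdiff_subset, hB'm, hB't⟩
      · rw [Function.update_of_ne (hne hi)]
        exact hB i hi

/-- If the measures `ν k` add up to at most the atomless measure `F`, then there are disjoint sets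
`B k` such that `F` restricted to `B k` agrees with `ν k` on the level sets of a simple function. -/
theorem exists_pairwiseDisjoint_fiber_eq {ι Y : Type*}
    (hF : ∀ η > 0, ∃ κ > 0, ∀ x : ℝ, F.real {θ : Set.Icc lo hi | |(θ : ℝ) - x| ≤ κ} ≤ η)
    (K : Finset ι) {ν : ι → Measure (Set.Icc lo hi)} (hν : ∑ k ∈ K, ν k ≤ F)
    (q : SimpleFunc (Set.Icc lo hi) Y) :
    ∃ B : ι → Set (Set.Icc lo hi), (K : Set ι).PairwiseDisjoint B ∧
      ∀ k ∈ K, MeasurableSet (B k) ∧ ∀ y, F (B k ∩ q ⁻¹' {y}) = ν k (q ⁻¹' {y}) := by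
  -- Each fiber of `q` is divided among the indices separately; `B k` collects the shares of `k`.
  have hsplit (y : Y) := exists_pairwiseDisjoint_measure_eq hF (q.measurableSet_fiber y) K
    (t := fun k => ν k (q ⁻¹' {y})) (by simpa using hν (q ⁻¹' {y}))
  choose B hdisj hB using hsplit
  have hsub {y k} (hk : k ∈ K) {θ} (h : θ ∈ B y k) : q θ = y := (hB y k hk).1 h
  have hmem {k θ} (hk : k ∈ K) : (θ ∈ ⋃ y ∈ q.range, B y k) ↔ θ ∈ B (q θ) k := by
    simp only [Set.mem_iUnion, exists_prop]
    refine ⟨fun ⟨y, _, h⟩ => ?_, fun h => ⟨q θ, q.mem_range_self θ, h⟩⟩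
    rwa [hsub hk h]
  refine ⟨fun k => ⋃ y ∈ q.range, B y k, ?_, fun k hk => ⟨?_, fun y => ?_⟩⟩
  · intro i hi j hj hij
    rw [Function.onFun, Set.disjoint_left]
    intro θ h1 h2
    exact (hdisj (q θ) hi hj hij).le_bot ⟨(hmem hi).1 h1, (hmem hj).1 h2⟩
  · exact Finset.measurableSet_biUnion _ fun y _ => (hB y k hk).2.1
  · rw [← (hB y k hk).2.2]
    congr 1
    ext θ
    rw [Set.mem_inter_iff, hmem hk]
    constructor
    · rintro ⟨h, hy⟩
      rwa [show q θ = y from hy] at h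
    · intro h
      have := hsub hk h
      exact ⟨by rwa [this], this⟩

end Splitting

theorem integral_comp_simpleFunc {X Y : Type*} [MeasurableSpace X] (μ : Measure X)
    [IsFiniteMeasure μ] (q : SimpleFunc X Y) (g : Y → ℝ) :
    ∫ x, g (q x) ∂μ = ∑ y ∈ q.range, μ.real (q ⁻¹' {y}) * g y := by
  have h : (fun x => g (q x)) = fun x => ∑ y ∈ q.range, (q ⁻¹' {y}).indicator (fun _ => g y) x := by
    ext x
    rw [Finset.sum_eq_single_of_mem (q x) (q.mem_range_self x), Set.indicator_of_mem (by simp)]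
    intro y _ hy
    exact Set.indicator_of_notMem (fun h : q x = y => hy h.symm) _
  rw [h, integral_finsetSum]
  · simp [integral_indicator_const, q.measurableSet_fiber]
  · exact fun y _ => (integrable_const _).indicator (q.measurableSet_fiber y)

theorem measureReal_preimage_simpleFunc {X Y : Type*} [MeasurableSpace X] (μ : Measure X)
    [IsFiniteMeasure μ] (q : SimpleFunc X Y) (V : Set Y) :
    μ.real (q ⁻¹' V) = ∑ y ∈ q.range, μ.real (q ⁻¹' {y}) * V.indicator 1 y := by
  rw [← integral_comp_simpleFunc, ← integral_indicator_one (q.measurableSet_preimage V)]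
  rfl

/-- If the measures `ν k` add up to at most the atomless measure `F`, then there are disjoint compact
sets `C k` such that `F` restricted to `C k` is close to `ν k`. -/
theorem exists_pairwiseDisjoint_isCompact {lo hi : ℝ} {F : Measure (Set.Icc lo hi)}
    [IsFiniteMeasure F] {ι : Type*}
    (hF : ∀ η > 0, ∃ κ > 0, ∀ x : ℝ, F.real {θ : Set.Icc lo hi | |(θ : ℝ) - x| ≤ κ} ≤ η)
    (K : Finset ι) {ν : ι → Measure (Set.Icc lo hi)} (hν : ∑ k ∈ K, ν k ≤ F)
    (T : Finset (Set.Icc lo hi → ℝ)) (hT : ∀ g ∈ T, Integrable g F) {η : ℝ} (hη : 0 < η) :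
    ∃ C : ι → Set (Set.Icc lo hi), (K : Set ι).PairwiseDisjoint C ∧
      ∀ k ∈ K, IsCompact (C k) ∧ (∀ g ∈ T, |∫ θ in C k, g θ ∂F - ∫ θ, g θ ∂(ν k)| ≤ η) ∧
        ∀ x : ℝ, |F.real (C k ∩ {θ | x ≤ θ}) - (ν k).real {θ | x ≤ θ}| ≤ η := by
  have hη4 : 0 < η / 4 := by linarith
  have hνF {k} (hk : k ∈ K) : ν k ≤ F := by
    refine Measure.le_iff.2 fun E _ => le_trans ?_ (hν E)
    rw [Measure.finsetSum_apply]
    exact Finset.single_le_sum (f := fun k => ν k E) (fun _ _ => zero_le) hk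
  obtain ⟨κ, hκ, hstrip⟩ := hF (η / 4) hη4
  -- a simple function that is close to all members of `T`
  obtain ⟨s, hs⟩ : ∃ s : SimpleFunc (Set.Icc lo hi) (T → ℝ), ∀ g : T,
      Integrable (fun θ => g.1 θ - s θ g) F ∧ ∫ θ, |g.1 θ - s θ g| ∂F ≤ η / 4 := by
    have hΦ : Integrable (fun θ (g : T) => g.1 θ) F := Integrable.of_eval fun g => hT g.1 g.2
    obtain ⟨s, hs, hs'⟩ := (memLp_one_iff_integrable.2 hΦ).exists_simpleFunc_eLpNorm_sub_lt
      ENNReal.one_ne_top (ENNReal.ofReal_pos.2 hη4).ne'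
    have hint : Integrable (fun θ => (fun g : T => g.1 θ) - s θ) F :=
      hΦ.sub (memLp_one_iff_integrable.1 hs')
    have hnorm : ∫ θ, ‖(fun g : T => g.1 θ) - s θ‖ ∂F ≤ η / 4 := by
      rw [integral_norm_eq_lintegral_enorm hint.aestronglyMeasurable]
      rw [eLpNorm_one_eq_lintegral_enorm] at hs
      exact ENNReal.toReal_le_of_le_ofReal hη4.le hs.le
    refine ⟨s, fun g => ⟨hint.eval g, (integral_mono (hint.eval g).abs hint.norm fun θ => ?_).trans
      hnorm⟩⟩
    exact norm_le_pi_norm ((fun g : T => g.1 θ) - s θ) g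
  -- Matching masses on intervals of length `κ` matches all upper tails up to one interval,
  -- uniformly in the threshold.
  let p : SimpleFunc (Set.Icc lo hi) ℤ :=
    { toFun := fun θ => ⌊(θ : ℝ) / κ⌋
      measurableSet_fiber' := fun y =>
        (show Measurable fun θ : Set.Icc lo hi => ⌊(θ : ℝ) / κ⌋ by fun_prop)
          (measurableSet_singleton y)
      finite_range' := by
        refine (Set.finite_Icc ⌊lo / κ⌋ ⌊hi / κ⌋).subset ?_
        rintro _ ⟨θ, rfl⟩
        have := θ.2.1
        have := θ.2.2
        constructor <;> (dsimp only; gcongr) }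
  have hp (θ : Set.Icc lo hi) : p θ = ⌊(θ : ℝ) / κ⌋ := rfl
  obtain ⟨B, hdisj, hB⟩ := exists_pairwiseDisjoint_fiber_eq hF K hν (s.pair p)
  have hHint : Integrable (fun θ => 1 + ∑ g ∈ T, |g θ|) F :=
    (integrable_const 1).add (integrable_finsetSum _ fun g hg => (hT g hg).abs)
  have hH0 (θ : Set.Icc lo hi) : 0 ≤ 1 + ∑ g ∈ T, |g θ| := by positivity
  -- Inner regularity for this weighted measure bounds the lost mass and the lost integral of every
  -- member of `T` at once.
  let ρ : Measure (Set.Icc lo hi) := F.withDensity fun θ => ENNReal.ofReal (1 + ∑ g ∈ T, |g θ|)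
  have : IsFiniteMeasure ρ := isFiniteMeasure_withDensity_ofReal hHint.2
  have hC (k : ι) : ∃ C ⊆ B k, k ∈ K → IsCompact C ∧
      ∫ θ in B k \ C, (1 + ∑ g ∈ T, |g θ|) ∂F ≤ η / 4 := by
    by_cases hk : k ∈ K
    swap
    · exact ⟨∅, Set.empty_subset _, fun h => absurd h hk⟩
    obtain ⟨C, hCB, hC, hCρ⟩ := (hB k hk).1.exists_isCompact_sdiff_lt (μ := ρ) (measure_ne_top _ _)
      (ENNReal.ofReal_pos.2 hη4).ne'
    refine ⟨C, hCB, fun _ => ⟨hC, ?_⟩⟩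
    rw [withDensity_apply _ ((hB k hk).1.diff hC.measurableSet),
      ← ofReal_integral_eq_lintegral_ofReal hHint.integrableOn (.of_forall hH0)] at hCρ
    exact (ENNReal.ofReal_lt_ofReal_iff hη4).1 hCρ |>.le
  choose C hCB hC using hC
  refine ⟨C, hdisj.mono fun k => hCB k, fun k hk => ⟨(hC k hk).1, ?_, ?_⟩⟩
  · intro g hg
    have : IsFiniteMeasure (ν k) := isFiniteMeasure_of_le F (hνF hk)
    have hBm := (hB k hk).1
    have hCm := (hC k hk).1.measurableSet
    obtain ⟨hs1, hs2⟩ := hs ⟨g, hg⟩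
    set h : Set.Icc lo hi → ℝ := fun θ => s θ ⟨g, hg⟩ with hh
    have hgi := hT g hg
    have hhi : Integrable h F := (hgi.sub hs1).congr (.of_forall fun θ => by simp [hh])
    have e1 : |∫ θ in B k, g θ ∂F - ∫ θ in C k, g θ ∂F| ≤ η / 4 := by
      rw [← setIntegral_sdiff hCm hgi.integrableOn (hCB k)]
      refine (abs_integral_le_integral_abs).trans (le_trans ?_ (hC k hk).2)
      refine integral_mono hgi.integrableOn.abs hHint.integrableOn fun θ => ?_
      have := Finset.single_le_sum (f := fun g => |g θ|) (fun _ _ => abs_nonneg _) hg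
      dsimp only at this ⊢
      linarith
    have e2 : |∫ θ in B k, g θ ∂F - ∫ θ in B k, h θ ∂F| ≤ η / 4 := by
      rw [← integral_sub hgi.integrableOn hhi.integrableOn]
      refine (abs_integral_le_integral_abs).trans (le_trans ?_ hs2)
      exact setIntegral_le_integral hs1.abs (.of_forall fun θ => abs_nonneg _)
    have e3 : ∫ θ in B k, h θ ∂F = ∫ θ, h θ ∂(ν k) := by
      have h1 := integral_comp_simpleFunc (F.restrict (B k)) (s.pair p) (fun y => y.1 ⟨g, hg⟩)
      have h2 := integral_comp_simpleFunc (ν k) (s.pair p) (fun y => y.1 ⟨g, hg⟩)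
      simp only [SimpleFunc.pair_apply] at h1 h2
      rw [h1, h2]
      refine Finset.sum_congr rfl fun y _ => ?_
      rw [measureReal_restrict_apply (SimpleFunc.measurableSet_fiber _ _), Set.inter_comm,
        measureReal_def, (hB k hk).2 y, measureReal_def]
    have e4 : |∫ θ, h θ ∂(ν k) - ∫ θ, g θ ∂(ν k)| ≤ η / 4 := by
      rw [← integral_sub (hhi.mono_measure (hνF hk)) (hgi.mono_measure (hνF hk))]
      refine (abs_integral_le_integral_abs).trans (le_trans ?_ hs2)
      simp_rw [abs_sub_comm (h _)]
      exact integral_mono_measure (hνF hk) (.of_forall fun θ => abs_nonneg _) hs1.abs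
    rw [abs_le] at *
    constructor <;> linarith [e1.1, e1.2, e2.1, e2.2, e4.1, e4.2]
  · intro x
    have : IsFiniteMeasure (ν k) := isFiniteMeasure_of_le F (hνF hk)
    -- The intervals strictly above that of `x`. Their union differs from the tail `{θ | x ≤ θ}` by
    -- a strip of mass at most `η / 4`, and `B k` matches `ν k` on it exactly.
    set A : Set (Set.Icc lo hi) := s.pair p ⁻¹' {y | ⌊x / κ⌋ < y.2} with hA
    have hAx : A ⊆ {θ | x ≤ θ} := by
      intro θ hθ
      have : ⌊x / κ⌋ < ⌊(θ : ℝ) / κ⌋ := hθ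
      by_contra hlt
      have hlt' : (θ : ℝ) ≤ x := (not_le.1 hlt).le
      exact absurd (Int.floor_le_floor (div_le_div_of_nonneg_right hlt' hκ.le)) (not_le.2 this)
    have hxA : {θ : Set.Icc lo hi | x ≤ θ} ⊆ A ∪ {θ | |(θ : ℝ) - x| ≤ κ} := by
      intro θ hθ
      have hxθ : x ≤ θ := hθ
      rcases (Int.floor_le_floor (div_le_div_of_nonneg_right hxθ hκ.le)).lt_or_eq with h | h
      · exact Or.inl h
      · refine Or.inr ?_
        have := (Int.abs_sub_lt_one_of_floor_eq_floor h.symm).le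
        rw [← sub_div, abs_div, abs_of_pos hκ, div_le_one hκ] at this
        exact this
    have hA_eq : F.real (B k ∩ A) = (ν k).real A := by
      have h1 := measureReal_preimage_simpleFunc (F.restrict (B k)) (s.pair p) {y | ⌊x / κ⌋ < y.2}
      have h2 := measureReal_preimage_simpleFunc (ν k) (s.pair p) {y | ⌊x / κ⌋ < y.2}
      rw [measureReal_restrict_apply (SimpleFunc.measurableSet_preimage _ _), Set.inter_comm] at h1
      rw [hA, h1, h2]
      refine Finset.sum_congr rfl fun y _ => ?_
      rw [measureReal_restrict_apply (SimpleFunc.measurableSet_fiber _ _), Set.inter_comm,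
        measureReal_def, (hB k hk).2 y, measureReal_def]
    have hdiff : F.real (B k \ C k) ≤ η / 4 := by
      refine le_trans ?_ (hC k hk).2
      rw [← mul_one (F.real _), ← smul_eq_mul, ← setIntegral_const]
      refine integral_mono (integrable_const _) hHint.integrableOn fun θ => ?_
      have : 0 ≤ ∑ g ∈ T, |g θ| := by positivity
      dsimp only
      linarith
    have i1 : F.real (C k ∩ {θ | x ≤ θ}) ≤ F.real (B k ∩ A) + η / 4 := by
      refine (measureReal_mono (s₂ := B k ∩ A ∪ {θ | |(θ : ℝ) - x| ≤ κ}) ?_).trans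
        ((measureReal_union_le _ _).trans (add_le_add_right (hstrip x) _))
      rintro θ ⟨h1, h2⟩
      exact (hxA h2).imp (fun h => ⟨hCB k h1, h⟩) id
    have i2 : (ν k).real A ≤ (ν k).real {θ | x ≤ θ} := measureReal_mono hAx
    have i3 : (ν k).real {θ | x ≤ θ} ≤ (ν k).real A + η / 4 := by
      refine (measureReal_mono hxA).trans ((measureReal_union_le _ _).trans
        (add_le_add_right (le_trans ?_ (hstrip x)) _))
      exact ENNReal.toReal_mono (measure_ne_top _ _) (hνF hk _)
    have i4 : F.real (B k ∩ A) ≤ F.real (C k ∩ {θ | x ≤ θ}) + η / 4 := by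
      refine (measureReal_mono (s₂ := C k ∩ {θ | x ≤ θ} ∪ B k \ C k) ?_).trans
        ((measureReal_union_le _ _).trans (add_le_add_right hdiff _))
      rintro θ ⟨h1, h2⟩
      by_cases h : θ ∈ C k
      · exact Or.inl ⟨h, hAx h2⟩
      · exact Or.inr ⟨h1, h⟩
    rw [abs_le]
    constructor <;> linarith

/-! ### Obedient laws of proposals and types -/

/-- A joint law of recommended proposals and types is obedient if its marginal on types is the
prior, proposals are nonnegative, and no event of recommendations makes a constant proposal a
profitable deviation. -/
structure IsObedientLaw {lo hi : ℝ} (F : Measure (Set.Icc lo hi)) (u : ℝ → ℝ)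
    (π : Measure (ℝ × Set.Icc lo hi)) : Prop where
  map_snd : π.map Prod.snd = F
  nonneg : ∀ᵐ x ∂π, 0 ≤ x.1
  integrable : Integrable (fun x => vetoProfit u x.1 x.2) π
  obedient : ∀ A : Set ℝ, MeasurableSet A → ∀ a : ℝ, 0 ≤ a →
    (u a - u 0) * π.real (A ×ˢ {θ : Set.Icc lo hi | a ≤ 2 * (θ : ℝ)}) ≤
      ∫ x in A ×ˢ Set.univ, vetoProfit u x.1 x.2 ∂π

theorem vetoProfit_nonneg {lo hi : ℝ} {u : ℝ → ℝ} (hu : StrictMono u) {a : ℝ} (ha : 0 ≤ a)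
    (θ : Set.Icc lo hi) : 0 ≤ vetoProfit u a θ := by
  unfold vetoProfit
  split_ifs
  · exact sub_nonneg.2 (hu.monotone ha)
  · exact le_rfl

/-- As types are nonnegative, a negative proposal is always accepted and is strictly worse than the
status quo. -/
theorem nonneg_of_mem_bestResponses {lo hi : ℝ} (hlo : 0 ≤ lo)
    {F : ProbabilityMeasure (Set.Icc lo hi)} {u : ℝ → ℝ} (hu : StrictMono u)
    {v : ℝ → Set.Icc lo hi → ℝ} {G : Measure (Set.Icc lo hi)} [IsProbabilityMeasure G] {a : ℝ}
    (ha : a ∈ (vetoGame F u v).bestResponses G) : 0 ≤ a := by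
  by_contra hneg
  rw [not_le] at hneg
  have h := ha 0
  simp only [vetoGame_uR] at h
  have h0 : (fun θ : Set.Icc lo hi => vetoProfit u 0 θ) = fun _ => 0 := by
    ext θ; simp [vetoProfit]
  have h1 : (fun θ : Set.Icc lo hi => vetoProfit u a θ) = fun _ => u a - u 0 := by
    ext θ
    have := θ.2.1
    rw [vetoProfit, if_pos (by linarith)]
  rw [h0, h1, integral_const, integral_const, probReal_univ, one_smul, one_smul] at h
  linarith [hu hneg]

/-- Achievable payoffs are the payoffs from an obedient law. -/
theorem exists_isObedientLaw_of_achievable {lo hi : ℝ} (hlo : 0 ≤ lo)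
    {F : ProbabilityMeasure (Set.Icc lo hi)} {u : ℝ → ℝ} (hu : StrictMono u)
    (hu_cont : Continuous u) {v : ℝ → Set.Icc lo hi → ℝ}
    (hv_int_statusQuo : Integrable (fun θ : Set.Icc lo hi => v 0 θ) (F : Measure (Set.Icc lo hi)))
    {uS uR : ℝ} (hach : (vetoGame F u v).Achievable (uS, uR)) :
    ∃ π : Measure (ℝ × Set.Icc lo hi), IsObedientLaw (F : Measure (Set.Icc lo hi)) u π ∧
      Integrable (fun x => vetoSurplus v x.1 x.2) π ∧
      ∫ θ, v 0 θ ∂(F : Measure (Set.Icc lo hi)) + ∫ x, vetoSurplus v x.1 x.2 ∂π = uS ∧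
      ∫ x, vetoProfit u x.1 x.2 ∂π = uR := by
  obtain ⟨σ, α, hα, hσ, hbest, hS_int, hR_int, hS, hR⟩ := hach
  set ς := (σ : ProbabilityMeasure _).1 with hς
  set π : Measure (ℝ × Set.Icc lo hi) := (α ×ₖ beliefKernel (Set.Icc lo hi)) ∘ₘ ς with hπ
  have hbel (G : ProbabilityMeasure (Set.Icc lo hi)) :
      beliefKernel (Set.Icc lo hi) G = (G : Measure (Set.Icc lo hi)) := rfl
  replace hσ : IsSegmentation F σ := hσ
  replace hS_int : Integrable (fun x => (vetoGame F u v).uS x.1 x.2) π := hS_int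
  replace hS : ∫ x, (vetoGame F u v).uS x.1 x.2 ∂π = uS := hS
  have hsnd : π.map Prod.snd = F := by
    ext B hB
    rw [Measure.map_apply measurable_snd hB, hπ,
      Measure.bind_apply (measurable_snd hB) (Kernel.aemeasurable _), ← hσ B hB]
    refine lintegral_congr fun G => ?_
    have : (Prod.snd ⁻¹' B : Set (ℝ × Set.Icc lo hi)) = Set.univ ×ˢ B := by ext; simp
    rw [Kernel.prod_apply, this, Measure.prod_prod, measure_univ, one_mul, hbel]
  have hfin : IsFiniteMeasure π := by
    refine ⟨?_⟩
    rw [← Set.preimage_univ (f := Prod.snd), ← Measure.map_apply measurable_snd .univ, hsnd]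
    exact measure_lt_top _ _
  have hnonneg : ∀ᵐ x ∂π, 0 ≤ x.1 := by
    refine Measure.ae_comp_of_ae_ae (measurableSet_le measurable_const measurable_fst) ?_
    filter_upwards [hbest] with G hG
    rw [Kernel.prod_apply]
    have : ∀ᵐ a ∂(α G), 0 ≤ a := hG.mono fun a ha => nonneg_of_mem_bestResponses hlo hu ha
    exact Measure.quasiMeasurePreserving_fst.ae this
  have hlint {A : Set ℝ} (hA : MeasurableSet A) {f : ℝ × Set.Icc lo hi → ENNReal}
      (hf : Measurable f) : ∫⁻ x in A ×ˢ Set.univ, f x ∂π =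
        ∫⁻ G, ∫⁻ a in A, ∫⁻ θ, f (a, θ) ∂(G : Measure (Set.Icc lo hi)) ∂(α G) ∂ς := by
    have hAm : MeasurableSet (A ×ˢ (Set.univ : Set (Set.Icc lo hi))) := hA.prod .univ
    rw [← lintegral_indicator hAm, hπ, Measure.lintegral_bind (Kernel.aemeasurable _)
      (hf.indicator hAm).aemeasurable]
    refine lintegral_congr fun G => ?_
    rw [Kernel.lintegral_prod _ _ _ (hf.indicator hAm), ← lintegral_indicator hA]
    refine lintegral_congr fun a => ?_
    by_cases ha : a ∈ A <;> simp [ha, hbel]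
  have hprof := measurable_uncurry_vetoProfit (lo := lo) (hi := hi) hu_cont
  refine ⟨π, ⟨hsnd, hnonneg, hR_int, fun A hA a' ha' => ?_⟩, ?_, ?_, hR⟩
  · have hprof' : Measurable fun x : ℝ × Set.Icc lo hi => vetoProfit u a' x.2 :=
      (measurable_vetoProfit u a').comp measurable_snd
    have hset : MeasurableSet (A ×ˢ (Set.univ : Set (Set.Icc lo hi))) := hA.prod .univ
    have hset' : MeasurableSet (A ×ˢ {θ : Set.Icc lo hi | a' ≤ 2 * (θ : ℝ)}) :=
      hA.prod (measurableSet_le (by fun_prop) (by fun_prop))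
    -- The best-response inequality, integrated over segments and over recommendations in `A`.
    -- Profits at nonnegative proposals are nonnegative, so lower integrals can be iterated without
    -- integrability conditions.
    have hle : ∫⁻ x in A ×ˢ Set.univ, ENNReal.ofReal (vetoProfit u a' x.2) ∂π ≤
        ∫⁻ x in A ×ˢ Set.univ, ENNReal.ofReal (vetoProfit u x.1 x.2) ∂π := by
      rw [hlint hA hprof'.ennreal_ofReal, hlint hA hprof.ennreal_ofReal]
      refine lintegral_mono_ae ?_
      filter_upwards [hbest] with G hG
      refine lintegral_mono_ae (ae_restrict_of_ae ?_)
      filter_upwards [hG] with a ha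
      have ha0 := nonneg_of_mem_bestResponses hlo hu ha
      rw [← ofReal_integral_eq_lintegral_ofReal (integrable_vetoProfit u a')
        (.of_forall (vetoProfit_nonneg hu ha')),
        ← ofReal_integral_eq_lintegral_ofReal (integrable_vetoProfit u a)
        (.of_forall (vetoProfit_nonneg hu ha0))]
      exact ENNReal.ofReal_le_ofReal (ha a')
    have hright : ∫⁻ x in A ×ˢ Set.univ, ENNReal.ofReal (vetoProfit u x.1 x.2) ∂π =
        ENNReal.ofReal (∫ x in A ×ˢ Set.univ, vetoProfit u x.1 x.2 ∂π) := by
      refine (ofReal_integral_eq_lintegral_ofReal (Integrable.integrableOn hR_int) ?_).symm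
      refine ae_restrict_of_ae ?_
      filter_upwards [hnonneg] with x hx
      exact vetoProfit_nonneg hu hx x.2
    have hleft : ∫⁻ x in A ×ˢ Set.univ, ENNReal.ofReal (vetoProfit u a' x.2) ∂π =
        ENNReal.ofReal ((u a' - u 0) * π.real (A ×ˢ {θ : Set.Icc lo hi | a' ≤ 2 * (θ : ℝ)})) := by
      rw [← lintegral_indicator hset, ENNReal.ofReal_mul (sub_nonneg.2 (hu.monotone ha')),
        ofReal_measureReal, ← lintegral_indicator_const hset']
      refine lintegral_congr fun x => ?_
      by_cases h1 : x.1 ∈ A <;> by_cases h2 : a' ≤ 2 * (x.2 : ℝ) <;>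
        simp [Set.indicator, vetoProfit, h1, h2]
    rw [hleft, hright] at hle
    refine (ENNReal.ofReal_le_ofReal_iff (integral_nonneg_of_ae (ae_restrict_of_ae ?_))).1 hle
    filter_upwards [hnonneg] with x hx
    exact vetoProfit_nonneg hu hx x.2
  all_goals
    have hv0 : Integrable (fun x : ℝ × Set.Icc lo hi => v 0 x.2) π := by
      rw [← hsnd] at hv_int_statusQuo
      exact hv_int_statusQuo.comp_measurable measurable_snd
    have hsub : (fun x : ℝ × Set.Icc lo hi => vetoSurplus v x.1 x.2) =
        fun x => (vetoGame F u v).uS x.1 x.2 - v 0 x.2 := by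
      ext x; rw [vetoGame_uS]; ring
    rw [hsub]
  · exact Integrable.sub hS_int hv0
  · have hv0' : ∫ x, v 0 x.2 ∂π = ∫ θ, v 0 θ ∂(F : Measure (Set.Icc lo hi)) := by
      rw [← hsnd] at hv_int_statusQuo
      rw [← hsnd, integral_map measurable_snd.aemeasurable hv_int_statusQuo.aestronglyMeasurable]
    rw [integral_sub hS_int hv0, hv0']
    linarith

theorem IsObedientLaw.isProbabilityMeasure {lo hi : ℝ} {F : Measure (Set.Icc lo hi)}
    [IsProbabilityMeasure F] {u : ℝ → ℝ} {π : Measure (ℝ × Set.Icc lo hi)}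
    (h : IsObedientLaw F u π) : IsProbabilityMeasure π := by
  refine ⟨?_⟩
  have := measure_univ (μ := F)
  rwa [← h.map_snd, Measure.map_apply measurable_snd .univ, Set.preimage_univ] at this

/-! ### A modulus of continuity for the sender's gains -/

/-- The gains of the sender have a modulus of continuity, uniform in the proposal, with an
arbitrarily small mean. -/
theorem exists_integrable_modulus {lo hi : ℝ} (hlo : 0 ≤ lo) {μ : Measure (Set.Icc lo hi)}
    {v : ℝ → Set.Icc lo hi → ℝ}
    (hv : ∀ θ : Set.Icc lo hi, IsSymmetricSinglePeaked (fun a => v a θ) (θ : ℝ))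
    (hv_meas : ∀ a : ℝ, Measurable (v a))
    (hv_int_statusQuo : Integrable (fun θ : Set.Icc lo hi => v 0 θ) μ)
    (hv_int_ideal : Integrable (fun θ : Set.Icc lo hi => v (θ : ℝ) θ) μ) {ε : ℝ} (hε : 0 < ε) :
    ∃ Δ > 0, ∃ ω : Set.Icc lo hi → ℝ, Integrable ω μ ∧ ∫ θ, ω θ ∂μ ≤ ε ∧
      ∀ θ a a', |a - a'| < Δ → |vetoSurplus v a θ - vetoSurplus v a' θ| ≤ ω θ := by
  -- The largest oscillation at scale `1 / (n + 1)`; restricting to rational pairs makes the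
  -- supremum countable, hence measurable.
  let D (n : ℕ) (θ : Set.Icc lo hi) : ENNReal := ⨆ p : {p : ℚ × ℚ // |(p.1 : ℝ) - p.2| < 1 / (n + 1)},
    ENNReal.ofReal |vetoSurplus v p.1.1 θ - vetoSurplus v p.1.2 θ|
  have hDmeas (n : ℕ) : Measurable (D n) := Measurable.iSup fun p =>
    ((measurable_vetoSurplus hv_meas _).sub (measurable_vetoSurplus hv_meas _)).abs.ennreal_ofReal
  have hDle (n : ℕ) (θ : Set.Icc lo hi) : D n θ ≤ ENNReal.ofReal (v θ θ - v 0 θ) := by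
    refine iSup_le fun p => ENNReal.ofReal_le_ofReal ?_
    rw [abs_le]
    have := vetoSurplus_le hv p.1.1 θ
    have := vetoSurplus_le hv p.1.2 θ
    have := vetoSurplus_nonneg (v := v) p.1.1 θ
    have := vetoSurplus_nonneg (v := v) p.1.2 θ
    constructor <;> linarith
  have hDtop (n : ℕ) (θ : Set.Icc lo hi) : D n θ ≠ ⊤ := ne_top_of_le_ne_top ENNReal.ofReal_ne_top (hDle n θ)
  have hH0 (θ : Set.Icc lo hi) : 0 ≤ v θ θ - v 0 θ := sub_nonneg.2 ((hv θ).le_peak 0)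
  have hbound (n : ℕ) (θ : Set.Icc lo hi) : ‖(D n θ).toReal‖ ≤ v θ θ - v 0 θ := by
    rw [Real.norm_of_nonneg ENNReal.toReal_nonneg]
    exact ENNReal.toReal_le_of_le_ofReal (hH0 θ) (hDle n θ)
  have hlim : Filter.Tendsto (fun n => ∫ θ, (D n θ).toReal ∂μ) Filter.atTop
      (nhds (∫ _, (0 : ℝ) ∂μ)) := by
    refine tendsto_integral_of_dominated_convergence (fun θ => v θ θ - v 0 θ)
      (fun n => (hDmeas n).ennreal_toReal.aestronglyMeasurable) (hv_int_ideal.sub hv_int_statusQuo)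
      (fun n => .of_forall (hbound n)) (.of_forall fun θ => ?_)
    -- The surplus vanishes outside `[0, 2 * θ]`, so continuity is uniform and `D n θ` tends to `0`
    -- for each `θ`.
    have hunif : UniformContinuous fun a => vetoSurplus v a θ := by
      refine HasCompactSupport.uniformContinuous_of_continuous ?_ (continuous_vetoSurplus hv θ)
      refine HasCompactSupport.intro (isCompact_Icc (a := (0 : ℝ)) (b := 2 * θ)) fun a ha => ?_
      rw [Set.mem_Icc, not_and_or, not_le, not_le] at ha
      rcases ha with ha | ha
      · exact vetoSurplus_eq_zero_of_nonpos hlo hv ha.le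
      · exact vetoSurplus_eq_zero_of_two_mul_le hlo hv ha.le
    rw [Metric.tendsto_atTop]
    intro η hη
    obtain ⟨r, hr, h⟩ := Metric.uniformContinuous_iff.1 hunif (η / 2) (by linarith)
    obtain ⟨N, hN⟩ := exists_nat_one_div_lt hr
    refine ⟨N, fun n hn => ?_⟩
    rw [Real.dist_eq, sub_zero, abs_of_nonneg ENNReal.toReal_nonneg]
    refine lt_of_le_of_lt (ENNReal.toReal_le_of_le_ofReal (by linarith) (iSup_le fun p => ?_))
      (half_lt_self hη)
    refine ENNReal.ofReal_le_ofReal (h ?_).le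
    refine lt_trans (lt_of_lt_of_le p.2 ?_) hN
    have : (N : ℝ) ≤ n := by exact_mod_cast hn
    gcongr
  rw [integral_zero] at hlim
  obtain ⟨n, hn⟩ := (hlim.eventually (gt_mem_nhds hε)).exists
  refine ⟨1 / (n + 1), by positivity, fun θ => (D n θ).toReal, ?_, hn.le, ?_⟩
  · exact (hv_int_ideal.sub hv_int_statusQuo).mono' (hDmeas n).ennreal_toReal.aestronglyMeasurable
      (.of_forall (hbound n))
  · intro θ a a' haa
    by_contra hlt
    rw [not_le] at hlt
    have hc := continuous_vetoSurplus hv θ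
    have hopen : IsOpen {x : ℝ × ℝ | |x.1 - x.2| < 1 / ((n : ℝ) + 1) ∧
        (D n θ).toReal < |vetoSurplus v x.1 θ - vetoSurplus v x.2 θ|} := by
      have h1 : Continuous fun x : ℝ × ℝ => |x.1 - x.2| := by fun_prop
      have h2 : Continuous fun x : ℝ × ℝ => |vetoSurplus v x.1 θ - vetoSurplus v x.2 θ| :=
        ((hc.comp continuous_fst).sub (hc.comp continuous_snd)).abs
      exact (isOpen_lt h1 continuous_const).inter (isOpen_lt continuous_const h2)
    -- A violation at real proposals is an open condition, so it would also occur at rational ones.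
    obtain ⟨p, hp1, hp2⟩ := (Rat.denseRange_cast.prodMap Rat.denseRange_cast).exists_mem_open hopen
      ⟨(a, a'), haa, hlt⟩
    refine not_le.2 hp2 ?_
    have := le_iSup (fun p : {p : ℚ × ℚ // |(p.1 : ℝ) - p.2| < 1 / (n + 1)} =>
      ENNReal.ofReal |vetoSurplus v p.1.1 θ - vetoSurplus v p.1.2 θ|) ⟨p, hp1⟩
    exact (ENNReal.ofReal_le_iff_le_toReal (hDtop n θ)).1 this

/-! ### Demand and tilting -/

/-- The mass of types that accept the proposal `a`. -/
noncomputable def demand {lo hi : ℝ} (μ : Measure (Set.Icc lo hi)) (a : ℝ) : ℝ :=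
  μ.real {θ | a ≤ 2 * (θ : ℝ)}

section Demand

variable {lo hi : ℝ} {μ : Measure (Set.Icc lo hi)} {u : ℝ → ℝ}

theorem measurableSet_accept (a : ℝ) : MeasurableSet {θ : Set.Icc lo hi | a ≤ 2 * (θ : ℝ)} :=
  measurableSet_le (by fun_prop) (by fun_prop)

theorem integral_vetoProfit (u : ℝ → ℝ) (a : ℝ) :
    ∫ θ, vetoProfit u a θ ∂μ = (u a - u 0) * demand μ a := by
  have : (fun θ : Set.Icc lo hi => vetoProfit u a θ) =
      {θ : Set.Icc lo hi | a ≤ 2 * (θ : ℝ)}.indicator fun _ => u a - u 0 := rfl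
  rw [this, integral_indicator_const _ (measurableSet_accept a), smul_eq_mul, mul_comm, demand]

theorem demand_nonneg (a : ℝ) : 0 ≤ demand μ a := measureReal_nonneg

theorem demand_antitone [IsFiniteMeasure μ] : Antitone (demand μ) := fun _ _ hab =>
  measureReal_mono fun _ hθ => hab.trans hθ

theorem demand_eq_zero {a : ℝ} (ha : 2 * hi < a) : demand μ a = 0 := by
  have : {θ : Set.Icc lo hi | a ≤ 2 * (θ : ℝ)} = ∅ := by
    ext θ
    simp only [Set.mem_ofPred_eq, Set.mem_empty_iff_false, iff_false, not_le]
    linarith [θ.2.2]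
  rw [demand, this, measureReal_empty]

theorem demand_mono [IsFiniteMeasure μ] {ν : Measure (Set.Icc lo hi)} (h : ν ≤ μ) (a : ℝ) : demand ν a ≤ demand μ a :=
  ENNReal.toReal_mono (measure_ne_top _ _) (h _)

end Demand

/-- At `h = 0` both left sides vanish while both right sides are positive. Compactness of `[p, M]`,
on which `w` is positive because `p > 0`, yields one step for all `b`. -/
theorem exists_pos_step {w : ℝ → ℝ} (hw : StrictMono w) (hw_cont : Continuous w) (hw0 : w 0 = 0)
    {p M ζ δ : ℝ} (hp : 0 < p) (hζ : 0 < ζ) (hδ : 0 < δ) :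
    ∃ h, 0 < h ∧ h < ζ ∧ ∀ b ∈ Set.Icc p M,
      1 - w b / w (b + h) < δ * (1 - w b / w (b + ζ)) ∧
      (1 - δ) * (1 - w b / w (b + h)) <
        δ * (w b - w (b - ζ)) * (1 / w (b + h) - 1 / w (b + ζ)) := by
  have hpos {x : ℝ} (hx : 0 < x) : 0 < w x := hw0 ▸ hw hx
  have hev : ∀ᶠ h in nhds (0 : ℝ), ∀ b ∈ Set.Icc p M,
      1 - w b / w (b + h) < δ * (1 - w b / w (b + ζ)) ∧
      (1 - δ) * (1 - w b / w (b + h)) <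
        δ * (w b - w (b - ζ)) * (1 / w (b + h) - 1 / w (b + ζ)) := by
    refine isCompact_Icc.eventually_forall_of_forall_eventually fun b hb => ?_
    have hb0 : 0 < b := hp.trans_le hb.1
    have h1 : ContinuousAt (fun z : ℝ × ℝ => w z.2) (0, b) := by fun_prop
    have h2 : ContinuousAt (fun z : ℝ × ℝ => w (z.2 + z.1)) (0, b) := by fun_prop
    have h3 : ContinuousAt (fun z : ℝ × ℝ => w (z.2 + ζ)) (0, b) := by fun_prop
    have h4 : ContinuousAt (fun z : ℝ × ℝ => w (z.2 - ζ)) (0, b) := by fun_prop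
    have n2 : w (b + 0) ≠ 0 := (hpos (by linarith)).ne'
    have n3 : w (b + ζ) ≠ 0 := (hpos (by linarith)).ne'
    have hlt : w b < w (b + ζ) := hw (by linarith)
    have hwb := hpos hb0
    have hwe : 0 < w (b + ζ) := hpos (by linarith)
    have h12 := h1.div h2 n2
    have h13 := h1.div h3 n3
    have hone : ContinuousAt (fun _ : ℝ × ℝ => (1 : ℝ)) (0, b) := continuousAt_const
    refine Filter.Eventually.and ?_ ?_
    · refine ContinuousAt.eventually_lt (hone.sub h12)
        ((hone.sub h13).const_mul δ) ?_
      dsimp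
      rw [add_zero, div_self hwb.ne', sub_self]
      exact mul_pos hδ (sub_pos.2 ((div_lt_one hwe).2 hlt))
    · refine ContinuousAt.eventually_lt ((hone.sub h12).const_mul (1 - δ))
        (((h1.sub h4).const_mul δ).mul ((hone.div h2 n2).sub (hone.div h3 n3))) ?_
      dsimp
      rw [add_zero, div_self hwb.ne', sub_self, mul_zero]
      refine mul_pos (mul_pos hδ (sub_pos.2 (hw (by linarith)))) (sub_pos.2 ?_)
      exact one_div_lt_one_div_of_lt hwb hlt
  have hIoo : ∀ᶠ h in nhdsWithin (0 : ℝ) (Set.Ioi 0), h ∈ Set.Ioo 0 ζ := Ioo_mem_nhdsGT hζ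
  obtain ⟨h, h1, h2⟩ := ((hev.filter_mono nhdsWithin_le_nhds).and hIoo).exists
  exact ⟨h, h2.1, h2.2, h1⟩

/-- The measure `G` with its mass outside the types in `[b / 2, e / 2)` scaled down by `1 - δ`. -/
noncomputable def tilt {lo hi : ℝ} (G : Measure (Set.Icc lo hi)) (δ b e : ℝ) :
    Measure (Set.Icc lo hi) :=
  ENNReal.ofReal (1 - δ) • G +
    ENNReal.ofReal δ • G.restrict {θ | b ≤ 2 * (θ : ℝ) ∧ 2 * (θ : ℝ) < e}

section Tilt

variable {lo hi : ℝ} {G : Measure (Set.Icc lo hi)} {δ b e : ℝ}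

theorem tilt_le (hδ0 : 0 ≤ δ) (hδ1 : δ ≤ 1) : tilt G δ b e ≤ G := by
  calc tilt G δ b e ≤ ENNReal.ofReal (1 - δ) • G + ENNReal.ofReal δ • G := by
        unfold tilt; gcongr; exact Measure.restrict_le_self
    _ = G := by
        rw [← add_smul, ← ENNReal.ofReal_add (by linarith) hδ0, sub_add_cancel, ENNReal.ofReal_one,
          one_smul]

theorem integral_tilt (hδ0 : 0 ≤ δ) (hδ1 : δ ≤ 1) {f : Set.Icc lo hi → ℝ} (hf : Integrable f G) :
    ∫ θ, f θ ∂(tilt G δ b e) = (1 - δ) * ∫ θ, f θ ∂G +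
      δ * ∫ θ in {θ | b ≤ 2 * (θ : ℝ) ∧ 2 * (θ : ℝ) < e}, f θ ∂G := by
  rw [tilt, integral_add_measure (hf.smul_measure ENNReal.ofReal_ne_top)
    (hf.integrableOn.smul_measure ENNReal.ofReal_ne_top), integral_smul_measure,
    integral_smul_measure, ENNReal.toReal_ofReal (by linarith), ENNReal.toReal_ofReal hδ0,
    smul_eq_mul, smul_eq_mul]

variable [IsFiniteMeasure G]

theorem demand_tilt (hδ0 : 0 ≤ δ) (hδ1 : δ ≤ 1) (x : ℝ) :
    demand (tilt G δ b e) x = (1 - δ) * demand G x +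
      δ * G.real ({θ | x ≤ 2 * (θ : ℝ)} ∩ {θ | b ≤ 2 * (θ : ℝ) ∧ 2 * (θ : ℝ) < e}) := by
  have h := integral_tilt (G := G) (b := b) (e := e) hδ0 hδ1
    ((integrable_const (1 : ℝ)).indicator (measurableSet_accept x))
  simp only [integral_indicator_const _ (measurableSet_accept x), smul_eq_mul, mul_one] at h
  rw [demand, demand, h, measureReal_restrict_apply (measurableSet_accept x)]

/-- All types whose mass is not scaled down accept `x`, so they contribute a bonus that is the same
for every `x ≤ b`. -/
theorem demand_tilt_of_le (hδ0 : 0 ≤ δ) (hδ1 : δ ≤ 1) (hbe : b ≤ e) {x : ℝ} (hx : x ≤ b) :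
    demand (tilt G δ b e) x = (1 - δ) * demand G x + δ * (demand G b - demand G e) := by
  rw [demand_tilt hδ0 hδ1]
  congr 2
  have : {θ : Set.Icc lo hi | x ≤ 2 * (θ : ℝ)} ∩ {θ | b ≤ 2 * (θ : ℝ) ∧ 2 * (θ : ℝ) < e} =
      {θ : Set.Icc lo hi | b ≤ 2 * (θ : ℝ)} \ {θ : Set.Icc lo hi | e ≤ 2 * (θ : ℝ)} := by
    ext θ
    simp only [Set.mem_inter_iff, Set.mem_ofPred_eq, Set.mem_sdiff, not_le]
    exact ⟨fun h => h.2, fun h => ⟨hx.trans h.1, h⟩⟩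
  have hsub : {θ : Set.Icc lo hi | e ≤ 2 * (θ : ℝ)} ⊆ {θ | b ≤ 2 * (θ : ℝ)} :=
    fun θ hθ => hbe.trans hθ
  rw [this, measureReal_sdiff hsub (measurableSet_accept e), demand, demand]

/-- Every type whose mass is not scaled down rejects `x`, so there is no bonus. -/
theorem demand_tilt_of_ge (hδ0 : 0 ≤ δ) (hδ1 : δ ≤ 1) {x : ℝ} (hx : e ≤ x) :
    demand (tilt G δ b e) x = (1 - δ) * demand G x := by
  rw [demand_tilt hδ0 hδ1]
  have : {θ : Set.Icc lo hi | x ≤ 2 * (θ : ℝ)} ∩ {θ | b ≤ 2 * (θ : ℝ) ∧ 2 * (θ : ℝ) < e} = ∅ := by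
    ext θ
    simp only [Set.mem_inter_iff, Set.mem_ofPred_eq, Set.mem_empty_iff_false, iff_false]
    intro h
    linarith [h.1, h.2.2]
  rw [this, measureReal_empty, mul_zero, add_zero]

/-- If `b` is nearly optimal against `G`, then proposals that are not close to `b` are worse than `b`
by a positive margin against the tilted measure. -/
theorem exists_pos_gap_tilt {w : ℝ → ℝ} (hw : StrictMono w) (hw0 : w 0 = 0) {c b' R : ℝ}
    (hδ0 : 0 ≤ δ) (hδ1 : δ ≤ 1) (hb : 0 < b) (hbc : b < c) (hce : c ≤ e) (hbb : b' ≤ b) (hR : 0 < R)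
    (hle : ∀ x, 0 ≤ x → w x * demand G x ≤ R) (hge : R ≤ w c * demand G b)
    (h1 : 1 - w b / w c < δ * (1 - w b / w e))
    (h2 : (1 - δ) * (1 - w b / w c) < δ * (w b - w b') * (1 / w c - 1 / w e)) :
    ∃ γ > 0, ∀ x, 0 ≤ x → x ∉ Set.Ioo b' e →
      w x * demand (tilt G δ b e) x + γ ≤ w b * demand (tilt G δ b e) b := by
  have hpos {x : ℝ} (hx : 0 < x) : 0 < w x := hw0 ▸ hw hx
  have hwb := hpos hb
  have hwc := hpos (hb.trans hbc)
  have hwe := hpos ((hb.trans hbc).trans_le hce)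
  -- The two bounds give `demand G b - demand G e ≥ R * (1 / w c - 1 / w e)`, so the favored types
  -- have positive mass.
  have hTb : R * (1 / w c) ≤ demand G b := by
    rw [mul_one_div, div_le_iff₀ hwc]; linarith
  have hTe : demand G e ≤ R * (1 / w e) := by
    rw [mul_one_div, le_div_iff₀ hwe]; linarith [hle e ((hb.trans hbc).trans_le hce).le]
  rw [div_eq_mul_one_div (w b) (w c), div_eq_mul_one_div (w b) (w e)] at h1
  rw [div_eq_mul_one_div (w b) (w c)] at h2
  set α := 1 / w c
  set β := 1 / w e
  refine ⟨R * min (δ * (1 - w b * β) - (1 - w b * α))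
    (δ * (w b - w b') * (α - β) - (1 - δ) * (1 - w b * α)),
    mul_pos hR (lt_min (by linarith) (by linarith)), fun x hx hxn => ?_⟩
  rw [demand_tilt_of_le hδ0 hδ1 (hbc.le.trans hce) le_rfl]
  rw [Set.mem_Ioo, not_and_or, not_lt, not_lt] at hxn
  have hx' := mul_le_mul_of_nonneg_left (hle x hx) (sub_nonneg.2 hδ1)
  -- A proposal up to `b'` keeps the favored types but charges them less; one from `e` on loses
  -- them. By `h2` and `h1`, respectively, this outweighs the suboptimality of `b` against `G`.
  rcases hxn with hxb | hxe
  · rw [demand_tilt_of_le hδ0 hδ1 (hbc.le.trans hce) (hxb.trans hbb)]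
    have hmin := mul_le_mul_of_nonneg_left (min_le_right (δ * (1 - w b * β) - (1 - w b * α))
      (δ * (w b - w b') * (α - β) - (1 - δ) * (1 - w b * α))) hR.le
    have hD0 : 0 ≤ demand G b - demand G e := sub_nonneg.2 (demand_antitone (hbc.le.trans hce))
    have hD : R * (α - β) ≤ demand G b - demand G e := by linarith
    have e1 : δ * (w x * (demand G b - demand G e)) ≤ δ * (w b' * (demand G b - demand G e)) :=
      mul_le_mul_of_nonneg_left (mul_le_mul_of_nonneg_right (hw.monotone hxb) hD0) hδ0
    have e2 := mul_le_mul_of_nonneg_left hD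
      (mul_nonneg hδ0 (sub_nonneg.2 (hw.monotone hbb)))
    have e3 := mul_le_mul_of_nonneg_left (mul_le_mul_of_nonneg_left hTb hwb.le) (sub_nonneg.2 hδ1)
    linarith
  · rw [demand_tilt_of_ge hδ0 hδ1 hxe]
    have hmin := mul_le_mul_of_nonneg_left (min_le_left (δ * (1 - w b * β) - (1 - w b * α))
      (δ * (w b - w b') * (α - β) - (1 - δ) * (1 - w b * α))) hR.le
    have e1 := mul_le_mul_of_nonneg_left hTb hwb.le
    have e2 := mul_le_mul_of_nonneg_left hTe (mul_nonneg hδ0 hwb.le)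
    linarith

end Tilt

/-! ### Existence and stability of best responses -/

section BestResponse

variable {lo hi : ℝ} {w : ℝ → ℝ}

theorem measureReal_eq_coe_eq_zero {F : Measure (Set.Icc lo hi)} [IsFiniteMeasure F]
    (hF : ∀ η > 0, ∃ κ > 0, ∀ x : ℝ, F.real {θ : Set.Icc lo hi | |(θ : ℝ) - x| ≤ κ} ≤ η) (x : ℝ) :
    F.real {θ | (θ : ℝ) = x} = 0 := by
  refine le_antisymm (le_of_forall_pos_le_add fun η hη => ?_) measureReal_nonneg
  obtain ⟨κ, hκ, h⟩ := hF η hη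
  rw [zero_add]
  refine le_trans (measureReal_mono fun θ hθ => ?_) (h x)
  have : (θ : ℝ) = x := hθ
  simp [this, hκ.le]

theorem continuous_demand_restrict {F : Measure (Set.Icc lo hi)} [IsFiniteMeasure F]
    (hF : ∀ η > 0, ∃ κ > 0, ∀ x : ℝ, F.real {θ : Set.Icc lo hi | |(θ : ℝ) - x| ≤ κ} ≤ η)
    (C : Set (Set.Icc lo hi)) : Continuous (demand (F.restrict C)) := by
  have h : demand (F.restrict C) = fun a => F.real C - F.real (C ∩ {θ | (θ : ℝ) ≤ a / 2}) := by
    ext a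
    rw [demand, measureReal_restrict_apply (measurableSet_accept a), ← measureReal_inter_add_sdiff (s := C)
      (measurableSet_le measurable_subtype_coe measurable_const :
        MeasurableSet {θ : Set.Icc lo hi | (θ : ℝ) ≤ a / 2}), add_sub_cancel_left]
    refine le_antisymm ?_ (measureReal_mono fun θ hθ => ⟨?_, hθ.1⟩)
    · rw [← add_zero (F.real (C \ _)), ← measureReal_eq_coe_eq_zero hF (a / 2)]
      refine (measureReal_mono fun θ hθ => ?_).trans (measureReal_union_le _ _)
      have h1 : a ≤ 2 * (θ : ℝ) := hθ.1
      by_cases h2 : (θ : ℝ) ≤ a / 2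
      · exact Or.inr (show (θ : ℝ) = a / 2 by linarith)
      · exact Or.inl ⟨hθ.2, h2⟩
    · have h2 : ¬ (θ : ℝ) ≤ a / 2 := hθ.2
      show a ≤ 2 * (θ : ℝ)
      linarith
  rw [h]
  exact continuous_const.sub ((continuous_measureReal_inter_le hF C).comp (continuous_id.div_const 2))

/-- Profit is zero at `0` and is not positive outside `[0, 2 * hi]`, so a maximizer on this compact
interval is a global one. -/
theorem exists_forall_profit_le {μ : Measure (Set.Icc lo hi)} (hμ : Continuous (demand μ))
    (hw : StrictMono w) (hw_cont : Continuous w) (hw0 : w 0 = 0) (hhi : 0 ≤ hi) :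
    ∃ a, ∀ a', w a' * demand μ a' ≤ w a * demand μ a := by
  obtain ⟨a, ha, h⟩ := isCompact_Icc.exists_isMaxOn (Set.nonempty_Icc.2 (show 0 ≤ 2 * hi by linarith))
    (hw_cont.mul hμ).continuousOn
  have hnn : 0 ≤ w a * demand μ a := by
    have := h (Set.left_mem_Icc.2 (show 0 ≤ 2 * hi by linarith))
    simpa [hw0] using this
  refine ⟨a, fun a' => ?_⟩
  rcases lt_or_ge a' 0 with h0 | h0
  · exact (mul_nonpos_of_nonpos_of_nonneg (hw0 ▸ (hw h0).le) (demand_nonneg a')).trans hnn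
  · rcases le_or_gt a' (2 * hi) with h1 | h1
    · exact h ⟨h0, h1⟩
    · rwa [demand_eq_zero h1, mul_zero]

/-- Best responses to a measure that is close to one with a strict margin are close to `b`. -/
theorem mem_Ioo_of_forall_profit_le {μ ν : Measure (Set.Icc lo hi)}
    (hw : StrictMono w) (hw0 : w 0 = 0) {b b' e γ η : ℝ} (hb : 0 < b) (hbhi : b ≤ 2 * hi)
    (hbe : b < e)
    (hgap : ∀ x, 0 ≤ x → x ∉ Set.Ioo b' e → w x * demand ν x + γ ≤ w b * demand ν b)
    (hη : 2 * (w (2 * hi) * η) < γ) (hη0 : 0 ≤ η) (hclose : ∀ x, |demand μ x - demand ν x| ≤ η) :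
    0 < demand μ b ∧ ∀ a, (∀ a', w a' * demand μ a' ≤ w a * demand μ a) →
      a ∈ Set.Ioo b' e ∧ 0 < a ∧ a ≤ 2 * hi := by
  have hpos {x : ℝ} (hx : 0 < x) : 0 < w x := hw0 ▸ hw hx
  have hwb := hpos hb
  have hwM : 0 ≤ w (2 * hi) * η := mul_nonneg (hwb.le.trans (hw.monotone hbhi)) hη0
  have hclose' {x : ℝ} (hx0 : 0 ≤ x) (hx : x ≤ 2 * hi) :
      |w x * demand μ x - w x * demand ν x| ≤ w (2 * hi) * η := by
    rw [← mul_sub, abs_mul, abs_of_nonneg (hw0 ▸ hw.monotone hx0)]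
    exact mul_le_mul (hw.monotone hx) (hclose x) (abs_nonneg _) (hwb.le.trans (hw.monotone hbhi))
  have hbclose := abs_le.1 (hclose' hb.le hbhi)
  -- The gap at `e`, the excluded endpoint, where profit is nonnegative.
  have hνb : γ ≤ w b * demand ν b := by
    have h := hgap e (hb.trans hbe).le (fun h => lt_irrefl _ h.2)
    have := mul_nonneg (hpos (hb.trans hbe)).le (demand_nonneg (μ := ν) e)
    linarith
  have hprofit : 0 < w b * demand μ b := by linarith [hbclose.1]
  refine ⟨pos_of_mul_pos_right hprofit hwb.le, fun a ha => ?_⟩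
  have hpa : 0 < w a * demand μ a := hprofit.trans_le (ha b)
  have ha0 : 0 < a := by
    by_contra h
    exact not_le.2 hpa (mul_nonpos_of_nonpos_of_nonneg (hw0 ▸ hw.monotone (not_lt.1 h))
      (demand_nonneg a))
  have haM : a ≤ 2 * hi := by
    by_contra h
    rw [demand_eq_zero (not_le.1 h), mul_zero] at hpa
    exact lt_irrefl _ hpa
  refine ⟨?_, ha0, haM⟩
  by_contra hn
  have h1 := hgap a ha0.le hn
  have h2 := abs_le.1 (hclose' ha0.le haM)
  linarith [ha b, h2.2, hbclose.1]

end BestResponse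

/-! ### Segments of recommendations -/

/-- The distribution of types on the event that the recommended proposal belongs to `A`. -/
noncomputable def segmentLaw {lo hi : ℝ} (π : Measure (ℝ × Set.Icc lo hi)) (A : Set ℝ) :
    Measure (Set.Icc lo hi) :=
  (π.restrict (A ×ˢ Set.univ)).map Prod.snd

section Segment

variable {lo hi : ℝ} {π : Measure (ℝ × Set.Icc lo hi)} {A : Set ℝ}

theorem segmentLaw_apply {B : Set (Set.Icc lo hi)} (hB : MeasurableSet B) :
    segmentLaw π A B = π (A ×ˢ B) := by
  rw [segmentLaw, Measure.map_apply measurable_snd hB,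
    Measure.restrict_apply (measurable_snd hB)]
  congr 1
  ext x
  simp [and_comm]

theorem demand_segmentLaw (a : ℝ) :
    demand (segmentLaw π A) a = π.real (A ×ˢ {θ : Set.Icc lo hi | a ≤ 2 * (θ : ℝ)}) := by
  rw [demand, measureReal_def, segmentLaw_apply (measurableSet_accept a), measureReal_def]

instance [IsFiniteMeasure π] : IsFiniteMeasure (segmentLaw π A) :=
  Measure.isFiniteMeasure_map _ _

theorem segmentLaw_le_map (π : Measure (ℝ × Set.Icc lo hi)) (A : Set ℝ) :
    segmentLaw π A ≤ π.map Prod.snd :=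
  Measure.map_mono Measure.restrict_le_self measurable_snd

theorem integral_segmentLaw {f : Set.Icc lo hi → ℝ} (hf : Integrable f (π.map Prod.snd)) :
    ∫ θ, f θ ∂(segmentLaw π A) = ∫ x in A ×ˢ Set.univ, f x.2 ∂π :=
  integral_map measurable_snd.aemeasurable (hf.mono_measure (segmentLaw_le_map π A)).aestronglyMeasurable

theorem sum_segmentLaw_le {ι : Type*} (K : Finset ι) {A : ι → Set ℝ}
    (hA : ∀ k ∈ K, MeasurableSet (A k)) (hdisj : (K : Set ι).PairwiseDisjoint A) :
    ∑ k ∈ K, segmentLaw π (A k) ≤ π.map Prod.snd := by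
  refine Measure.le_iff.2 fun B hB => ?_
  rw [Measure.finsetSum_apply, Measure.map_apply measurable_snd hB,
    Finset.sum_congr rfl fun k _ => segmentLaw_apply hB,
    ← measure_biUnion_finset (fun i hi j hj hij => ?_) fun k hk => (hA k hk).prod hB]
  · exact measure_mono (Set.iUnion₂_subset fun k _ x hx => hx.2)
  · exact Set.disjoint_prod.2 (Or.inl (hdisj hi hj hij))

end Segment

theorem setIntegral_profit_nonpos_of_two_mul_lt {lo hi : ℝ} (u : ℝ → ℝ)
    (π : Measure (ℝ × Set.Icc lo hi)) {A : Set ℝ} (hA : MeasurableSet A)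
    (hAhi : ∀ a ∈ A, 2 * hi < a) :
    ∫ x in A ×ˢ Set.univ, vetoProfit u x.1 x.2 ∂π ≤ 0 := by
  refine setIntegral_nonpos (hA.prod .univ) fun x hx => ?_
  rw [vetoProfit, if_neg]
  have := hAhi _ hx.1
  linarith [x.2.2.2]

theorem pairwise_disjoint_Ico_add_mul (p : ℝ) {s : ℝ} (hs : 0 < s) :
    Pairwise (Function.onFun Disjoint fun k : ℕ => Set.Ico (p + k * s) (p + (k + 1) * s)) := by
  have hdisj {i j : ℕ} (hij : i < j) :
      Disjoint (Set.Ico (p + i * s) (p + (i + 1) * s)) (Set.Ico (p + j * s) (p + (j + 1) * s)) := by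
    have : ((i : ℝ) + 1) * s ≤ j * s := by
      have : ((i : ℝ) + 1) ≤ j := by exact_mod_cast hij
      gcongr
    exact Set.disjoint_left.2 fun a h1 h2 => by linarith [h1.2, h2.1]
  exact fun i j hij => hij.lt_or_gt.elim hdisj fun h => (hdisj h).symm

namespace IsObedientLaw

variable {lo hi : ℝ} {F : Measure (Set.Icc lo hi)} {u : ℝ → ℝ}
  {π : Measure (ℝ × Set.Icc lo hi)}

theorem integrable_snd (h : IsObedientLaw F u π) {f : Set.Icc lo hi → ℝ} (hf : Integrable f F) :
    Integrable (fun x => f x.2) π := by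
  rw [← h.map_snd] at hf
  exact hf.comp_measurable measurable_snd

theorem integral_snd (h : IsObedientLaw F u π) {f : Set.Icc lo hi → ℝ} (hf : Integrable f F) :
    ∫ x, f x.2 ∂π = ∫ θ, f θ ∂F := by
  rw [← h.map_snd] at hf ⊢
  rw [integral_map measurable_snd.aemeasurable hf.aestronglyMeasurable]

theorem obedient_segmentLaw (h : IsObedientLaw F u π) {A : Set ℝ} (hA : MeasurableSet A) {a : ℝ}
    (ha : 0 ≤ a) :
    (u a - u 0) * demand (segmentLaw π A) a ≤ ∫ x in A ×ˢ Set.univ, vetoProfit u x.1 x.2 ∂π := by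
  rw [demand_segmentLaw]
  exact h.obedient A hA a ha

/-- A set of recommendations that yields no profit is negligible. -/
theorem measure_prod_univ_eq_zero [IsProbabilityMeasure F] (h : IsObedientLaw F u π) (hu : StrictMono u) (hlo : 0 ≤ lo)
    (hF : ∀ η > 0, ∃ κ > 0, ∀ x : ℝ, F.real {θ : Set.Icc lo hi | |(θ : ℝ) - x| ≤ κ} ≤ η)
    {A : Set ℝ} (hA : MeasurableSet A)
    (hle : ∫ x in A ×ˢ Set.univ, vetoProfit u x.1 x.2 ∂π ≤ 0) : π (A ×ˢ Set.univ) = 0 := by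
  have := h.isProbabilityMeasure
  -- Types that accept `1 / (n + 1)` would make it a profitable deviation, so they are null. This
  -- leaves only the type `0`, which is not an atom.
  have hz (n : ℕ) : π (A ×ˢ {θ : Set.Icc lo hi | 1 / ((n : ℝ) + 1) ≤ 2 * (θ : ℝ)}) = 0 := by
    have hn : (0 : ℝ) < 1 / ((n : ℝ) + 1) := by positivity
    have h1 := (h.obedient A hA _ hn.le).trans hle
    rw [← measureReal_eq_zero_iff]
    exact le_antisymm (nonpos_of_mul_nonpos_right h1 (sub_pos.2 (hu hn))) measureReal_nonneg
  have h0 : π (Set.univ ×ˢ {θ : Set.Icc lo hi | (θ : ℝ) = 0}) = 0 := by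
    have hm : MeasurableSet {θ : Set.Icc lo hi | (θ : ℝ) = 0} :=
      measurable_subtype_coe (measurableSet_singleton 0)
    have : F {θ : Set.Icc lo hi | (θ : ℝ) = 0} = 0 :=
      (measureReal_eq_zero_iff).1 (measureReal_eq_coe_eq_zero hF 0)
    rwa [← h.map_snd, Measure.map_apply measurable_snd hm, ← Set.univ_prod] at this
  refine measure_mono_null ?_ (measure_union_null (measure_iUnion_null hz) h0)
  rintro ⟨a, θ⟩ ⟨ha, -⟩
  rcases (hlo.trans θ.2.1).eq_or_lt with hθ | hθ
  · exact Or.inr ⟨trivial, hθ.symm⟩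
  · obtain ⟨n, hn⟩ := exists_nat_one_div_lt (show 0 < 2 * (θ : ℝ) by linarith)
    exact Or.inl (Set.mem_iUnion.2 ⟨n, ha, hn.le⟩)

/-- Integrals decompose along the recommendations below `p` and those in the profitable cells of a
grid that starts at `p`. -/
theorem integral_eq_add_sum [IsProbabilityMeasure F] (h : IsObedientLaw F u π) (hu : StrictMono u) (hlo : 0 ≤ lo)
    (hF : ∀ η > 0, ∃ κ > 0, ∀ x : ℝ, F.real {θ : Set.Icc lo hi | |(θ : ℝ) - x| ≤ κ} ≤ η)
    {p s : ℝ} (hs : 0 < s) {n : ℕ} (hn : 2 * hi < p + n * s) {f : ℝ × Set.Icc lo hi → ℝ}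
    (hf : Integrable f π) (K : Finset ℕ)
    (hK : ∀ k < n, k ∉ K → ∫ x in Set.Ico (p + k * s) (p + (k + 1) * s) ×ˢ Set.univ,
      vetoProfit u x.1 x.2 ∂π ≤ 0) :
    ∫ x, f x ∂π = ∫ x in Set.Iio p ×ˢ Set.univ, f x ∂π +
      ∑ k ∈ K, ∫ x in Set.Ico (p + k * s) (p + (k + 1) * s) ×ˢ Set.univ, f x ∂π := by
  have hlow : MeasurableSet (Set.Iio p ×ˢ (Set.univ : Set (Set.Icc lo hi))) :=
    measurableSet_Iio.prod .univ
  have hcell (k : ℕ) : MeasurableSet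
      (Set.Ico (p + k * s) (p + (k + 1) * s) ×ˢ (Set.univ : Set (Set.Icc lo hi))) :=
    measurableSet_Ico.prod .univ
  rw [← integral_add_compl hlow hf, ← integral_biUnion_finset K (fun k _ => hcell k)
    (fun i _ j _ hij => Set.disjoint_prod.2 (Or.inl (pairwise_disjoint_Ico_add_mul p hs hij))) fun k _ => hf.integrableOn]
  congr 1
  refine setIntegral_congr_set (Filter.eventuallyEq_set.2 ?_)
  have hhigh : π (Set.Ici (p + n * s) ×ˢ Set.univ) = 0 :=
    h.measure_prod_univ_eq_zero hu hlo hF measurableSet_Ici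
      (setIntegral_profit_nonpos_of_two_mul_lt u π measurableSet_Ici fun a ha => hn.trans_le ha)
  have hskip : π (⋃ k ∈ (Finset.range n).filter (· ∉ K),
      Set.Ico (p + k * s) (p + (k + 1) * s) ×ˢ (Set.univ : Set (Set.Icc lo hi))) = 0 := by
    refine measure_iUnion_null fun k => measure_iUnion_null fun hk => ?_
    rw [Finset.mem_filter, Finset.mem_range] at hk
    exact h.measure_prod_univ_eq_zero hu hlo hF measurableSet_Ico (hK k hk.1 hk.2)
  have hnull := measure_union_null hhigh hskip
  filter_upwards [measure_eq_zero_iff_ae_notMem.1 hnull] with x hx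
  simp only [Set.mem_union, Set.mem_prod, Set.mem_Ici, Set.mem_univ, and_true, Set.mem_iUnion,
    Finset.mem_filter, Finset.mem_range, exists_prop, not_or, not_le, not_exists] at hx
  simp only [Set.mem_compl_iff, Set.mem_prod, Set.mem_Iio, Set.mem_univ, and_true, not_lt,
    Set.mem_iUnion, exists_prop]
  constructor
  · intro hpx
    set k := ⌊(x.1 - p) / s⌋₊ with hk
    have h0 : 0 ≤ (x.1 - p) / s := div_nonneg (by linarith) hs.le
    have h1 : (k : ℝ) * s ≤ x.1 - p := (le_div_iff₀ hs).1 (Nat.floor_le h0)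
    have h2 : x.1 - p < (k + 1) * s := (div_lt_iff₀ hs).1 (Nat.lt_floor_add_one _)
    have hkn : k < n := by
      have : (k : ℝ) * s < n * s := by linarith [hx.1]
      exact_mod_cast lt_of_mul_lt_mul_right this hs.le
    have hmem : x.1 ∈ Set.Ico (p + k * s) (p + (k + 1) * s) := ⟨by linarith, by linarith⟩
    refine ⟨k, ?_, hmem⟩
    by_contra hkK
    exact hx.2 k ⟨⟨hkn, hkK⟩, hmem⟩
  · rintro ⟨k, -, hk⟩
    have : 0 ≤ (k : ℝ) * s := by positivity
    linarith [hk.1]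

/-- If only low proposals are recommended to some types, then these types are mostly low. -/
theorem setIntegral_Iio_le [IsProbabilityMeasure F] (h : IsObedientLaw F u π) (hu : StrictMono u) (hu_cont : Continuous u)
    (hlo : 0 ≤ lo) {p x : ℝ} (hp : 0 < p) (hx : 0 < x) :
    ∫ y in Set.Iio p ×ˢ Set.univ, (u (2 * y.2) - u 0) ∂π ≤
      (u x - u 0) + (u (2 * hi) - u 0) * ((u p - u 0) / (u x - u 0)) := by
  have := h.isProbabilityMeasure
  have hlohi : lo ≤ hi := by
    obtain ⟨θ⟩ := nonempty_of_isProbabilityMeasure F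
    exact θ.2.1.trans θ.2.2
  have hwx : 0 < u x - u 0 := sub_pos.2 (hu hx)
  have hwp : 0 < u p - u 0 := sub_pos.2 (hu hp)
  have hW : 0 ≤ u (2 * hi) - u 0 := sub_nonneg.2 (hu.monotone (by linarith))
  have hg := h.integrable_snd (integrable_fullProfit (μ := F) hu hu_cont)
  have hmass (s : Set (ℝ × Set.Icc lo hi)) : π.real s ≤ 1 := measureReal_le_one
  have hprofit : ∫ y in Set.Iio p ×ˢ Set.univ, vetoProfit u y.1 y.2 ∂π ≤ u p - u 0 := by
    calc ∫ y in Set.Iio p ×ˢ Set.univ, vetoProfit u y.1 y.2 ∂π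
        ≤ ∫ _ in Set.Iio p ×ˢ (Set.univ : Set (Set.Icc lo hi)), (u p - u 0) ∂π := by
          refine setIntegral_mono_on h.integrable.integrableOn integrableOn_const
            (measurableSet_Iio.prod .univ) fun y hy => ?_
          have : y.1 ≤ p := (show y.1 < p from hy.1).le
          unfold vetoProfit
          split_ifs
          · exact sub_le_sub_right (hu.monotone this) _
          · exact hwp.le
      _ ≤ u p - u 0 := by
          rw [setIntegral_const, smul_eq_mul]
          exact mul_le_of_le_one_left hwp.le (hmass _)
  -- Otherwise deviating to `x` would beat the profit `u p - u 0`, the most that recommendations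
  -- below `p` can yield.
  have hdem : demand (segmentLaw π (Set.Iio p)) x ≤ (u p - u 0) / (u x - u 0) := by
    rw [le_div_iff₀ hwx, mul_comm]
    exact (h.obedient_segmentLaw measurableSet_Iio hx.le).trans hprofit
  have hint : Integrable (fun θ : Set.Icc lo hi => (u x - u 0) +
      {θ : Set.Icc lo hi | x ≤ 2 * (θ : ℝ)}.indicator (fun _ => u (2 * hi) - u 0) θ)
      (segmentLaw π (Set.Iio p)) :=
    (integrable_const _).add ((integrable_const _).indicator (measurableSet_accept x))
  rw [← integral_segmentLaw (f := fun θ => u (2 * θ) - u 0)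
    (by rw [h.map_snd]; exact integrable_fullProfit hu hu_cont)]
  calc ∫ θ, (u (2 * θ) - u 0) ∂(segmentLaw π (Set.Iio p))
      ≤ ∫ θ, ((u x - u 0) + {θ : Set.Icc lo hi | x ≤ 2 * (θ : ℝ)}.indicator
          (fun _ => u (2 * hi) - u 0) θ) ∂(segmentLaw π (Set.Iio p)) := by
        refine integral_mono (integrable_fullProfit hu hu_cont) hint fun θ => ?_
        by_cases hθ : x ≤ 2 * (θ : ℝ)
        · have : u (2 * θ) ≤ u (2 * hi) := hu.monotone (by linarith [θ.2.2])
          simp only [Set.indicator, Set.mem_ofPred_eq, hθ, if_true]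
          linarith
        · have : u (2 * θ) ≤ u x := hu.monotone (not_le.1 hθ).le
          simp only [Set.indicator, Set.mem_ofPred_eq, hθ, if_false]
          linarith
    _ = (segmentLaw π (Set.Iio p)).real Set.univ * (u x - u 0) +
          (u (2 * hi) - u 0) * demand (segmentLaw π (Set.Iio p)) x := by
        rw [integral_add (integrable_const _) ((integrable_const _).indicator
          (measurableSet_accept x)), integral_const, smul_eq_mul,
          integral_indicator_const _ (measurableSet_accept x), smul_eq_mul,
          mul_comm (u (2 * hi) - u 0), demand]
    _ ≤ _ := by
        refine add_le_add (mul_le_of_le_one_left hwx.le ?_) (mul_le_mul_of_nonneg_left hdem hW)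
        rw [measureReal_def, segmentLaw_apply .univ]
        exact hmass _

end IsObedientLaw

/-! ### Payoffs from one cell -/

namespace IsObedientLaw

variable {lo hi : ℝ} {F : Measure (Set.Icc lo hi)} {u : ℝ → ℝ}
  {π : Measure (ℝ × Set.Icc lo hi)}

/-- The profit from a cell of recommendations is at most what the right end of the cell yields at
the demand of the left end. -/
theorem setIntegral_Ico_le [IsProbabilityMeasure F] (h : IsObedientLaw F u π) (hu : StrictMono u) {b c : ℝ} (hc : 0 ≤ c) :
    ∫ x in Set.Ico b c ×ˢ Set.univ, vetoProfit u x.1 x.2 ∂π ≤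
      (u c - u 0) * demand (segmentLaw π (Set.Ico b c)) b := by
  have := h.isProbabilityMeasure
  have hind : Integrable ({θ : Set.Icc lo hi | b ≤ 2 * (θ : ℝ)}.indicator fun _ => u c - u 0)
      (π.map Prod.snd) := by
    rw [h.map_snd]
    exact (integrable_const _).indicator (measurableSet_accept b)
  have hwc : 0 ≤ u c - u 0 := sub_nonneg.2 (hu.monotone hc)
  rw [mul_comm, demand, ← smul_eq_mul, ← integral_indicator_const _ (measurableSet_accept b),
    integral_segmentLaw hind]
  refine setIntegral_mono_on h.integrable.integrableOn
    (h.integrable_snd ((integrable_const _).indicator (measurableSet_accept b))).integrableOn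
    (measurableSet_Ico.prod .univ) fun x hx => ?_
  have hx1 : b ≤ x.1 := hx.1.1
  have hx2 : x.1 < c := hx.1.2
  unfold vetoProfit
  split_ifs with hacc
  · have hmem : x.2 ∈ {θ : Set.Icc lo hi | b ≤ 2 * (θ : ℝ)} := hx1.trans hacc
    rw [Set.indicator_of_mem hmem]
    exact sub_le_sub_right (hu.monotone hx2.le) _
  · exact Set.indicator_nonneg (fun _ _ => hwc) _

/-- If a compact set of types approximates the tilted distribution of the types that are recommended
a proposal in `[b, c)`, then the best responses to it are close to `b`, and yield the receiver almost
the profit from these recommendations. -/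
theorem exists_margin [IsProbabilityMeasure F] (h : IsObedientLaw F u π) (hu : StrictMono u) {b c ζ δ : ℝ}
    (hδ0 : 0 ≤ δ) (hδ1 : δ ≤ 1) (hb : 0 < b) (hbc : b < c) (hcζ : c ≤ b + ζ)
    (h1 : 1 - (u b - u 0) / (u c - u 0) < δ * (1 - (u b - u 0) / (u (b + ζ) - u 0)))
    (h2 : (1 - δ) * (1 - (u b - u 0) / (u c - u 0)) <
      δ * ((u b - u 0) - (u (b - ζ) - u 0)) * (1 / (u c - u 0) - 1 / (u (b + ζ) - u 0)))
    (hbhi : b ≤ 2 * hi)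
    (hR : 0 < ∫ x in Set.Ico b c ×ˢ Set.univ, vetoProfit u x.1 x.2 ∂π) :
    ∃ γ > 0, ∀ η, 0 ≤ η → 2 * ((u (2 * hi) - u 0) * η) < γ → ∀ μ : Measure (Set.Icc lo hi),
      (∀ x, |demand μ x - demand (tilt (segmentLaw π (Set.Ico b c)) δ b (b + ζ)) x| ≤ η) →
      0 < demand μ b ∧ ∀ a, (∀ a', (u a' - u 0) * demand μ a' ≤ (u a - u 0) * demand μ a) →
        |a - b| < ζ ∧ |(u a - u 0) * demand μ a -
          ∫ x in Set.Ico b c ×ˢ Set.univ, vetoProfit u x.1 x.2 ∂π| ≤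
          2 * δ * ∫ x in Set.Ico b c ×ˢ Set.univ, vetoProfit u x.1 x.2 ∂π +
            (u (2 * hi) - u 0) * η := by
  have := h.isProbabilityMeasure
  set R := ∫ x in Set.Ico b c ×ˢ Set.univ, vetoProfit u x.1 x.2 ∂π with hRdef
  set G := segmentLaw π (Set.Ico b c) with hG
  have hw : StrictMono fun a => u a - u 0 := fun a a' haa => sub_lt_sub_right (hu haa) _
  have hw0 : (fun a => u a - u 0) 0 = 0 := sub_self _
  have hζ : b < b + ζ := hbc.trans_le hcζ
  have hle (x : ℝ) (hx : 0 ≤ x) : (u x - u 0) * demand G x ≤ R :=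
    h.obedient_segmentLaw measurableSet_Ico hx
  have hge : R ≤ (u c - u 0) * demand G b := h.setIntegral_Ico_le hu (hb.trans hbc).le
  obtain ⟨γ, hγ, hgap⟩ := exists_pos_gap_tilt (G := G) (b' := b - ζ) hw hw0 hδ0 hδ1 hb hbc hcζ
    (by linarith) hR hle hge h1 h2
  refine ⟨γ, hγ, fun η hη0 hη μ hclose => ?_⟩
  obtain ⟨hpos, hbr⟩ := mem_Ioo_of_forall_profit_le hw hw0 hb hbhi hζ hgap hη hη0 hclose
  refine ⟨hpos, fun a ha => ?_⟩
  obtain ⟨hmem, ha0, haM⟩ := hbr a ha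
  have hW : 0 ≤ u (2 * hi) - u 0 := sub_nonneg.2 (hu.monotone (hb.le.trans hbhi))
  have hwa : 0 ≤ u a - u 0 := sub_nonneg.2 (hu.monotone ha0.le)
  have hwb : 0 < u b - u 0 := sub_pos.2 (hu hb)
  have hwc : 0 < u c - u 0 := sub_pos.2 (hu (hb.trans hbc))
  have hwe : 0 < u (b + ζ) - u 0 := sub_pos.2 (hu (hb.trans hζ))
  refine ⟨abs_lt.2 ⟨by linarith [hmem.1], by linarith [hmem.2]⟩, ?_⟩
  -- Tilting only removes mass, so obedience of the original segment bounds the profit from above.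
  have hupper : (u a - u 0) * demand μ a ≤ R + (u (2 * hi) - u 0) * η := by
    have e1 : (u a - u 0) * demand μ a ≤ (u a - u 0) * (demand G a + η) := by
      refine mul_le_mul_of_nonneg_left ?_ hwa
      have e2 := (abs_le.1 (hclose a)).2
      have e3 := demand_mono (tilt_le (b := b) (e := b + ζ) hδ0 hδ1) a (μ := G)
      linarith
    have e2 : (u a - u 0) * η ≤ (u (2 * hi) - u 0) * η :=
      mul_le_mul_of_nonneg_right (sub_le_sub_right (hu.monotone haM) _) hη0
    have e3 := hle a ha0.le
    linarith
  -- The proposal `b` is available. It loses at most a factor `1 - δ` from replacing `c` by `b` in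
  -- the price and another from tilting, and `(1 - δ) ^ 2 ≥ 1 - 2 * δ`.
  have hlower : (1 - 2 * δ) * R - (u (2 * hi) - u 0) * η ≤ (u a - u 0) * demand μ a := by
    have e1 : (1 - δ) * demand G b - η ≤ demand μ b := by
      have e2 := (abs_le.1 (hclose b)).1
      rw [demand_tilt_of_le hδ0 hδ1 hζ.le le_rfl] at e2
      have e3 : 0 ≤ δ * (demand G b - demand G (b + ζ)) :=
        mul_nonneg hδ0 (sub_nonneg.2 (demand_antitone hζ.le))
      linarith
    have e2 : (u b - u 0) * η ≤ (u (2 * hi) - u 0) * η :=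
      mul_le_mul_of_nonneg_right (sub_le_sub_right (hu.monotone hbhi) _) hη0
    have e3 : 1 - δ ≤ (u b - u 0) / (u c - u 0) := by
      have : δ * (1 - (u b - u 0) / (u (b + ζ) - u 0)) ≤ δ * 1 :=
        mul_le_mul_of_nonneg_left (by linarith [div_nonneg hwb.le hwe.le]) hδ0
      linarith
    have e4 : (1 - δ) * R ≤ (u b - u 0) * demand G b := by
      calc (1 - δ) * R ≤ (u b - u 0) / (u c - u 0) * ((u c - u 0) * demand G b) :=
            mul_le_mul e3 hge hR.le (div_nonneg hwb.le hwc.le)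
        _ = (u b - u 0) * demand G b := by field_simp
    have e5 := mul_le_mul_of_nonneg_left e4 (sub_nonneg.2 hδ1)
    have e6 := mul_le_mul_of_nonneg_left e1 hwb.le
    have e7 : 0 ≤ δ * δ * R := by positivity
    linarith [ha b]
  have hδR : 0 ≤ δ * R := mul_nonneg hδ0 hR.le
  rw [abs_le]
  constructor <;> linarith

/-- The integral of a function against a tilted segment differs little from the one against the
segment. -/
theorem abs_integral_tilt_sub_le (h : IsObedientLaw F u π) {A : Set ℝ} {δ b e : ℝ}
    (hδ0 : 0 ≤ δ) (hδ1 : δ ≤ 1) {f g : Set.Icc lo hi → ℝ} (hf : Integrable f F)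
    (hg : Integrable g F) (hf0 : ∀ θ, 0 ≤ f θ) (hfg : ∀ θ, f θ ≤ g θ) :
    |∫ θ, f θ ∂(tilt (segmentLaw π A) δ b e) - ∫ x in A ×ˢ Set.univ, f x.2 ∂π| ≤
      δ * ∫ x in A ×ˢ Set.univ, g x.2 ∂π := by
  rw [← h.map_snd] at hf hg
  have hf' := hf.mono_measure (segmentLaw_le_map π A)
  have hg' := hg.mono_measure (segmentLaw_le_map π A)
  rw [integral_tilt hδ0 hδ1 hf', ← integral_segmentLaw hf, ← integral_segmentLaw hg]
  have h1 := setIntegral_le_integral (s := {θ : Set.Icc lo hi | b ≤ 2 * (θ : ℝ) ∧ 2 * (θ : ℝ) < e}) hf'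
    (.of_forall hf0)
  have h2 : 0 ≤ ∫ θ in {θ | b ≤ 2 * (θ : ℝ) ∧ 2 * (θ : ℝ) < e}, f θ ∂(segmentLaw π A) :=
    integral_nonneg hf0
  have h3 := mul_le_mul_of_nonneg_left (integral_mono hf' hg' hfg) hδ0
  have h4 := mul_le_mul_of_nonneg_left h1 hδ0
  have h5 := mul_nonneg hδ0 h2
  rw [abs_le]
  constructor <;> linarith

/-- The gains of the sender from a cell of recommendations are close to her gains from a proposal
close to the cell that is made to a set of types that approximates the tilted segment. -/
theorem abs_setIntegral_surplus_sub_le (h : IsObedientLaw F u π) {v : ℝ → Set.Icc lo hi → ℝ}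
    (hv : ∀ θ : Set.Icc lo hi, IsSymmetricSinglePeaked (fun a => v a θ) (θ : ℝ))
    (hv_meas : ∀ a : ℝ, Measurable (v a))
    (hv_int_statusQuo : Integrable (fun θ : Set.Icc lo hi => v 0 θ) F)
    (hv_int_ideal : Integrable (fun θ : Set.Icc lo hi => v (θ : ℝ) θ) F)
    (hS : Integrable (fun x => vetoSurplus v x.1 x.2) π)
    {Δ : ℝ} {ω : Set.Icc lo hi → ℝ} (hω_int : Integrable ω F)
    (hω : ∀ θ a a', |a - a'| < Δ → |vetoSurplus v a θ - vetoSurplus v a' θ| ≤ ω θ)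
    {b c e δ η a : ℝ} (hδ0 : 0 ≤ δ) (hδ1 : δ ≤ 1) (hc : c ≤ b + Δ) (ha : |a - b| < Δ)
    {C : Set (Set.Icc lo hi)}
    (hC : |∫ θ in C, vetoSurplus v b θ ∂F -
      ∫ θ, vetoSurplus v b θ ∂(tilt (segmentLaw π (Set.Ico b c)) δ b e)| ≤ η) :
    |∫ θ in C, vetoSurplus v a θ ∂F -
        ∫ x in Set.Ico b c ×ˢ Set.univ, vetoSurplus v x.1 x.2 ∂π| ≤
      ∫ θ in C, ω θ ∂F + η + δ * ∫ x in Set.Ico b c ×ˢ Set.univ, (v x.2 x.2 - v 0 x.2) ∂π +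
        ∫ x in Set.Ico b c ×ˢ Set.univ, ω x.2 ∂π := by
  have hφ (a : ℝ) := integrable_vetoSurplus hv hv_meas hv_int_statusQuo hv_int_ideal a
  have e1 : |∫ θ in C, vetoSurplus v a θ ∂F - ∫ θ in C, vetoSurplus v b θ ∂F| ≤
      ∫ θ in C, ω θ ∂F := by
    rw [← integral_sub (hφ a).integrableOn (hφ b).integrableOn]
    exact abs_integral_le_integral_abs.trans (integral_mono
      ((hφ a).integrableOn.sub (hφ b).integrableOn).abs hω_int.integrableOn fun θ => hω θ a b ha)
  have e2 := h.abs_integral_tilt_sub_le (A := Set.Ico b c) (b := b) (e := e) hδ0 hδ1 (hφ b)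
    (hv_int_ideal.sub hv_int_statusQuo) (vetoSurplus_nonneg b) (vetoSurplus_le hv b)
  have e3 : |∫ x in Set.Ico b c ×ˢ Set.univ, vetoSurplus v b x.2 ∂π -
      ∫ x in Set.Ico b c ×ˢ Set.univ, vetoSurplus v x.1 x.2 ∂π| ≤
      ∫ x in Set.Ico b c ×ˢ Set.univ, ω x.2 ∂π := by
    have hb := (h.integrable_snd (hφ b)).integrableOn (s := Set.Ico b c ×ˢ Set.univ)
    rw [← integral_sub hb hS.integrableOn]
    refine abs_integral_le_integral_abs.trans (setIntegral_mono_on (hb.sub hS.integrableOn).abs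
      (h.integrable_snd hω_int).integrableOn (measurableSet_Ico.prod .univ) fun x hx => ?_)
    have hx1 : b ≤ x.1 := hx.1.1
    have hx2 : x.1 < c := hx.1.2
    exact hω x.2 b x.1 (abs_lt.2 ⟨by linarith, by linarith⟩)
  simp only [Pi.sub_apply] at e2
  rw [abs_le] at *
  constructor <;> linarith [e1.1, e1.2, e2.1, e2.2, e3.1, e3.2, hC.1, hC.2]

end IsObedientLaw

/-! ### Choice of parameters and conclusion -/

/-- Conditioning multiplies all profits by the same nonnegative constant. -/
theorem mem_bestResponses_cond {lo hi : ℝ} (F : ProbabilityMeasure (Set.Icc lo hi)) (u : ℝ → ℝ)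
    (v : ℝ → Set.Icc lo hi → ℝ) {C : Set (Set.Icc lo hi)} {a : ℝ}
    (ha : ∀ a', (u a' - u 0) * demand ((F : Measure (Set.Icc lo hi)).restrict C) a' ≤
      (u a - u 0) * demand ((F : Measure (Set.Icc lo hi)).restrict C) a) :
    a ∈ (vetoGame F u v).bestResponses (F : Measure (Set.Icc lo hi))[|C] := by
  intro a'
  simp only [vetoGame_uR, ProbabilityTheory.cond, integral_smul_measure, integral_vetoProfit,
    smul_eq_mul]
  exact mul_le_mul_of_nonneg_left (ha a') ENNReal.toReal_nonneg

theorem exists_pos_lt_and_sub_lt {u : ℝ → ℝ} (hu_cont : Continuous u) {r t : ℝ} (hr : 0 < r)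
    (ht : 0 < t) : ∃ x, 0 < x ∧ x < r ∧ u x - u 0 < t := by
  have h1 : ∀ᶠ x in nhdsWithin (0 : ℝ) (Set.Ioi 0), u x - u 0 < t := by
    refine Filter.Eventually.filter_mono nhdsWithin_le_nhds ?_
    refine ContinuousAt.eventually_lt (by fun_prop) continuousAt_const ?_
    simpa using ht
  have h2 : ∀ᶠ x in nhdsWithin (0 : ℝ) (Set.Ioi 0), x ∈ Set.Ioo 0 r := Ioo_mem_nhdsGT hr
  obtain ⟨x, hx1, hx2⟩ := (h1.and h2).exists
  exact ⟨x, hx2.1, hx2.2, hx1⟩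

theorem exists_pos_forall_mul_lt {ι : Type*} (K : Finset ι) {γ : ι → ℝ} (hγ : ∀ k ∈ K, 0 < γ k)
    (A B : ℝ) {t : ℝ} (ht : 0 < t) : ∃ η > 0, (∀ k ∈ K, A * η < γ k) ∧ B * η < t := by
  have h (c : ℝ) {r : ℝ} (hr : 0 < r) : ∀ᶠ η in nhdsWithin (0 : ℝ) (Set.Ioi 0), c * η < r := by
    refine Filter.Eventually.filter_mono nhdsWithin_le_nhds ?_
    refine ContinuousAt.eventually_lt (by fun_prop) continuousAt_const ?_
    simpa using hr
  have h1 : ∀ᶠ η in nhdsWithin (0 : ℝ) (Set.Ioi 0), ∀ k ∈ K, A * η < γ k :=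
    (Filter.eventually_all_finset K).2 fun k hk => h A (hγ k hk)
  obtain ⟨η, ⟨hη1, hη2⟩, hη⟩ := ((h1.and (h B ht)).and self_mem_nhdsWithin).exists
  exact ⟨η, hη, hη1, hη2⟩

theorem proposition3 (lo hi : ℝ) (hlo : 0 ≤ lo)
    (F : ProbabilityMeasure (Set.Icc lo hi))
    (hF : (F : Measure (Set.Icc lo hi)).map (fun θ : Set.Icc lo hi => (θ : ℝ)) ≪ volume)
    (u : ℝ → ℝ) (hu : StrictMono u) (hu_cont : Continuous u)
    (v : ℝ → Set.Icc lo hi → ℝ)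
    (hv : ∀ θ : Set.Icc lo hi, IsSymmetricSinglePeaked (fun a => v a θ) (θ : ℝ))
    (hv_meas : ∀ a : ℝ, Measurable (v a))
    (hv_int_statusQuo : Integrable (fun θ : Set.Icc lo hi => v 0 θ) (F : Measure (Set.Icc lo hi)))
    (hv_int_ideal : Integrable (fun θ : Set.Icc lo hi => v (θ : ℝ) θ) (F : Measure (Set.Icc lo hi)))
    (uS uR : ℝ) (hach : (vetoGame F u v).Achievable (uS, uR))
    (ε : ℝ) (hε : 0 < ε) :
    ∃ uS' uR' : ℝ, (vetoGame F u v).Supportable (uS', uR') ∧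
      |uS' - uS| < ε ∧ |uR' - uR| < ε := by
  classical
  obtain ⟨π, h, hS_int, hS_eq, hR_eq⟩ :=
    exists_isObedientLaw_of_achievable hlo hu hu_cont hv_int_statusQuo hach
  set P : Measure (Set.Icc lo hi) := (F : Measure (Set.Icc lo hi)) with hP
  have hprob : IsProbabilityMeasure P := by rw [hP]; infer_instance
  have := h.isProbabilityMeasure
  have hunif : ∀ η > 0, ∃ κ > 0, ∀ x : ℝ, P.real {θ : Set.Icc lo hi | |(θ : ℝ) - x| ≤ κ} ≤ η :=
    fun η hη => exists_pos_forall_measureReal_le P hF hη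
  obtain ⟨θ₀⟩ := nonempty_of_isProbabilityMeasure P
  have hhi : 0 ≤ hi := hlo.trans (θ₀.2.1.trans θ₀.2.2)
  have hw : StrictMono fun a => u a - u 0 := fun a a' haa => sub_lt_sub_right (hu haa) _
  have hw_cont : Continuous fun a => u a - u 0 := hu_cont.sub continuous_const
  have hw0 : (fun a => u a - u 0) 0 = 0 := sub_self _
  -- the payoffs from full disclosure and from the ideal policy
  set W := u (2 * hi) - u 0 with hW
  have hW0 : 0 ≤ W := sub_nonneg.2 (hu.monotone (by linarith))
  set g : Set.Icc lo hi → ℝ := fun θ => u (2 * θ) - u 0 with hg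
  have hg_int : Integrable g P := integrable_fullProfit hu hu_cont
  have hg0 (θ : Set.Icc lo hi) : 0 ≤ g θ :=
    sub_nonneg.2 (hu.monotone (by linarith [hlo.trans θ.2.1]))
  have hgW : ∫ θ, g θ ∂P ≤ W := by
    have : ∫ θ, g θ ∂P ≤ ∫ _, W ∂P := integral_mono hg_int (integrable_const _) fun θ =>
      sub_le_sub_right (hu.monotone (by linarith [θ.2.2])) _
    simpa using this
  set H : Set.Icc lo hi → ℝ := fun θ => v θ θ - v 0 θ with hH
  have hH_int : Integrable H P := hv_int_ideal.sub hv_int_statusQuo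
  have hH0 (θ : Set.Icc lo hi) : 0 ≤ H θ := sub_nonneg.2 ((hv θ).le_peak 0)
  set IH := ∫ θ, H θ ∂P with hIH
  have hIH0 : 0 ≤ IH := integral_nonneg hH0
  -- the parameters of the construction
  obtain ⟨Δ, hΔ, ω, hω_int, hω_le, hω⟩ := exists_integrable_modulus hlo hv hv_meas
    hv_int_statusQuo hv_int_ideal (show 0 < ε / 8 by linarith)
  have hω0 (θ : Set.Icc lo hi) : 0 ≤ ω θ :=
    (abs_nonneg _).trans (hω θ 0 0 (by simpa using hΔ))
  -- First `x`, then `p` much smaller: `setIntegral_Iio_le` then bounds full extraction from the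
  -- types with recommendations below `p` by `ε / 8 + ε / 8`. The `1` in `W + 1` guards against
  -- division by zero.
  obtain ⟨x, hx0, -, hx⟩ := exists_pos_lt_and_sub_lt hu_cont hΔ (show 0 < ε / 8 by linarith)
  have hwx : 0 < u x - u 0 := sub_pos.2 (hu hx0)
  obtain ⟨p, hp0, hpΔ, hp⟩ := exists_pos_lt_and_sub_lt hu_cont hΔ
    (show 0 < ε / 8 * (u x - u 0) / (W + 1) by positivity)
  have hpx : W * ((u p - u 0) / (u x - u 0)) ≤ ε / 8 := by
    have hwp : 0 < u p - u 0 := sub_pos.2 (hu hp0)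
    rw [lt_div_iff₀ (by linarith)] at hp
    rw [← mul_div_assoc, div_le_iff₀ hwx]
    linarith
  -- One `δ` covers the tilting error `δ * IH` of the sender and `3 * δ * W` of the receiver.
  obtain ⟨δ, hδ0, hδ1, hδ⟩ : ∃ δ, 0 < δ ∧ δ ≤ 1 ∧ δ * (IH + 3 * W + 1) ≤ ε / 8 := by
    have hden : 0 < IH + 3 * W + 1 := by positivity
    exact ⟨min 1 (ε / 8 / (IH + 3 * W + 1)), lt_min one_pos (by positivity), min_le_left _ _,
      (le_div_iff₀ hden).1 (min_le_right _ _)⟩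
  obtain ⟨s, hs0, hsΔ, hs⟩ := exists_pos_step hw hw_cont hw0 (M := 2 * hi) hp0 hΔ hδ0
  obtain ⟨n, hn⟩ := exists_nat_gt ((2 * hi - p) / s)
  replace hn : 2 * hi < p + n * s := by linarith [(div_lt_iff₀ hs0).1 hn]
  -- the cells of recommendations and the messages
  set cell : ℕ → Set ℝ := fun k => Set.Ico (p + k * s) (p + (k + 1) * s) with hcell
  set R : ℕ → ℝ := fun k => ∫ y in cell k ×ˢ Set.univ, vetoProfit u y.1 y.2 ∂π with hRdef
  -- Only cells with positive profit have a margin; the others are null by obedience.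
  set K := (Finset.range n).filter fun k => 0 < R k with hK
  have hKR {k : ℕ} (hk : k ∈ K) : 0 < R k := (Finset.mem_filter.1 hk).2
  have hKcard : (K.card : ℝ) ≤ n := by
    have := Finset.card_filter_le (Finset.range n) fun k => 0 < R k
    rw [Finset.card_range] at this
    exact_mod_cast this
  have hbp (k : ℕ) : p ≤ p + k * s := by linarith [mul_nonneg k.cast_nonneg hs0.le]
  have hbhi {k : ℕ} (hk : k ∈ K) : p + k * s ≤ 2 * hi := by
    by_contra hlt
    exact not_le.2 (hKR hk) (setIntegral_profit_nonpos_of_two_mul_lt u π measurableSet_Ico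
      fun a ha => (not_le.1 hlt).trans_le ha.1)
  have hmargin : ∀ k ∈ K, ∃ γ > 0, ∀ η, 0 ≤ η → 2 * (W * η) < γ → ∀ μ : Measure (Set.Icc lo hi),
      (∀ x, |demand μ x -
        demand (tilt (segmentLaw π (cell k)) δ (p + k * s) (p + k * s + Δ)) x| ≤ η) →
      0 < demand μ (p + k * s) ∧
      ∀ a, (∀ a', (u a' - u 0) * demand μ a' ≤ (u a - u 0) * demand μ a) →
        |a - (p + k * s)| < Δ ∧ |(u a - u 0) * demand μ a - R k| ≤ 2 * δ * R k + W * η := by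
    intro k hk
    have hc : p + (k + 1) * s = p + k * s + s := by ring
    obtain ⟨h1, h2⟩ := hs (p + k * s) ⟨hbp k, hbhi hk⟩
    rw [← hc] at h1 h2
    exact h.exists_margin hu hδ0.le hδ1 (hp0.trans_le (hbp k)) (by linarith) (by linarith) h1 h2
      (hbhi hk) (hKR hk)
  choose! γ hγ hmargin using hmargin
  -- The margins do not depend on the approximating sets, so one `η` can undercut all of them; it
  -- also keeps the sum of at most `n` approximation errors below `ε / 8`.
  obtain ⟨η, hη0, hηγ, hηn⟩ := exists_pos_forall_mul_lt K hγ (2 * W) (n * (1 + W))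
    (show 0 < ε / 8 by linarith)
  set ν : ℕ → Measure (Set.Icc lo hi) := fun k =>
    tilt (segmentLaw π (cell k)) δ (p + k * s) (p + k * s + Δ) with hν
  have hνP : ∑ k ∈ K, ν k ≤ P := by
    refine (Finset.sum_le_sum fun k _ => tilt_le hδ0.le hδ1).trans ?_
    rw [← h.map_snd]
    exact sum_segmentLaw_le K (fun k _ => measurableSet_Ico)
      fun i _ j _ hij => pairwise_disjoint_Ico_add_mul p hs0 hij
  have hφ (a : ℝ) := integrable_vetoSurplus hv hv_meas hv_int_statusQuo hv_int_ideal a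
  obtain ⟨C, hCdisj, hC⟩ := exists_pairwiseDisjoint_isCompact hunif K hνP
    (insert g (K.image fun k : ℕ => vetoSurplus v (p + k * s))) (by
      intro f hf
      rcases Finset.mem_insert.1 hf with rfl | hf
      · exact hg_int
      · obtain ⟨k, -, rfl⟩ := Finset.mem_image.1 hf
        exact hφ _) hη0
  have hCg {k : ℕ} (hk : k ∈ K) := (hC k hk).2.1 g (Finset.mem_insert_self _ _)
  have hCφ {k : ℕ} (hk : k ∈ K) := (hC k hk).2.1 (vetoSurplus v (p + k * s))
    (Finset.mem_insert_of_mem (Finset.mem_image_of_mem _ hk))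
  have hCdem {k : ℕ} (hk : k ∈ K) (x : ℝ) : |demand (P.restrict (C k)) x - demand (ν k) x| ≤ η := by
    have hset : {θ : Set.Icc lo hi | x ≤ 2 * (θ : ℝ)} = {θ : Set.Icc lo hi | x / 2 ≤ (θ : ℝ)} := by
      ext θ
      exact ⟨fun h => show x / 2 ≤ (θ : ℝ) by linarith [show x ≤ 2 * (θ : ℝ) from h],
        fun h => show x ≤ 2 * (θ : ℝ) by linarith [show x / 2 ≤ (θ : ℝ) from h]⟩
    have := (hC k hk).2.2 (x / 2)
    rwa [demand, demand, measureReal_restrict_apply (measurableSet_accept x), Set.inter_comm, hset]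
  have hbest {k : ℕ} (hk : k ∈ K) := hmargin k hk η hη0.le (by linarith [hηγ k hk])
    (P.restrict (C k)) (hCdem hk)
  have hCpos {k : ℕ} (hk : k ∈ K) : P (C k) ≠ 0 := by
    intro h0
    have h1 := (hbest hk).1
    rw [Measure.restrict_eq_zero.2 h0] at h1
    simp [demand] at h1
  have hCm {k : ℕ} (hk : k ∈ K) : MeasurableSet (C k) := (hC k hk).1.measurableSet
  have hm : ∀ k ∈ K, ∃ m : NonemptyCompacts (Set.Icc lo hi), (m : Set (Set.Icc lo hi)) = C k :=
    fun k hk => ⟨⟨⟨C k, (hC k hk).1⟩, nonempty_of_measure_ne_zero (hCpos hk)⟩, rfl⟩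
  have : Nonempty (NonemptyCompacts (Set.Icc lo hi)) := ⟨{θ₀}⟩
  -- Positive mass makes each `C k` a nonempty message and, with disjointness, makes distinct cells
  -- yield distinct messages.
  choose! m hm using hm
  have hm_inj : Set.InjOn m K := by
    intro i hi j hj hij
    by_contra hne
    have hCC : C i = C j := by rw [← hm i hi, ← hm j hj, hij]
    have hd := hCdisj hi hj hne
    rw [Function.onFun, ← hCC, disjoint_self] at hd
    exact hCpos hi (by rw [hd]; exact measure_empty)
  have hact (m : NonemptyCompacts (Set.Icc lo hi)) :
      ∃ a, ∀ a', (u a' - u 0) * demand (P.restrict (m : Set (Set.Icc lo hi))) a' ≤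
        (u a - u 0) * demand (P.restrict (m : Set (Set.Icc lo hi))) a :=
    exists_forall_profit_le (continuous_demand_restrict hunif _) hw hw_cont hw0 hhi
  choose act hact using hact
  have hsupp := supportable_disclose hlo F hu hu_cont hv hv_meas hv_int_statusQuo hv_int_ideal
    (S := K.image m) (act := act) (by
      rw [Finset.coe_image]
      rintro _ ⟨i, hi, rfl⟩ _ ⟨j, hj, rfl⟩ hij
      rw [Function.onFun, hm i hi, hm j hj]
      exact hCdisj hi hj fun h => hij (h ▸ rfl)) (by
      intro m' hm'
      obtain ⟨k, hk, rfl⟩ := Finset.mem_image.1 hm'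
      rw [hm k hk]
      exact hCpos hk) (fun m' _ => mem_bestResponses_cond F u v (hact m'))
  rw [Finset.sum_image hm_inj, Finset.sum_image hm_inj] at hsupp
  refine ⟨_, _, hsupp, ?_, ?_⟩
  all_goals
    have hbest' {k : ℕ} (hk : k ∈ K) := (hbest hk).2 (act (m k)) (by
      rw [← hm k hk]; exact hact (m k))
    have hdecomp {f : ℝ × Set.Icc lo hi → ℝ} (hf : Integrable f π) :=
      h.integral_eq_add_sum hu hlo hunif hs0 hn hf K fun k hk hkK => by
        by_contra hlt
        exact hkK (Finset.mem_filter.2 ⟨Finset.mem_range.2 hk, not_le.1 hlt⟩)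
  · have hterm {k : ℕ} (hk : k ∈ K) := h.abs_setIntegral_surplus_sub_le hv hv_meas
      hv_int_statusQuo hv_int_ideal hS_int hω_int hω hδ0.le hδ1
      (show p + (k + 1) * s ≤ p + k * s + Δ by linarith) (hbest' hk).1 (hCφ hk)
    have hsum := (Finset.abs_sum_le_sum_abs _ K).trans (Finset.sum_le_sum fun k hk => hterm hk)
    simp only [Finset.sum_sub_distrib, Finset.sum_add_distrib, Finset.sum_const, nsmul_eq_mul,
      ← Finset.mul_sum] at hsum
    -- Disjointness bounds the total modulus over the pools by one integral under the prior,
    -- whatever the number of cells.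
    have hCω : ∑ k ∈ K, ∫ θ in C k, ω θ ∂P ≤ ∫ θ, ω θ ∂P := by
      rw [← integral_biUnion_finset K (fun k hk => hCm hk) hCdisj fun k _ => hω_int.integrableOn]
      exact setIntegral_le_integral hω_int (.of_forall hω0)
    have dS := hdecomp hS_int
    have dω := hdecomp (h.integrable_snd hω_int)
    have dH := hdecomp (h.integrable_snd hH_int)
    rw [h.integral_snd hω_int] at dω
    rw [h.integral_snd hH_int] at dH
    have hlowH : 0 ≤ ∫ y in Set.Iio p ×ˢ Set.univ, H y.2 ∂π := integral_nonneg fun y => hH0 y.2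
    have hlow0 : 0 ≤ ∫ y in Set.Iio p ×ˢ Set.univ, vetoSurplus v y.1 y.2 ∂π :=
      integral_nonneg fun y => vetoSurplus_nonneg y.1 y.2
    -- These recommendations lie within `Δ` of the proposal `0`, which yields no surplus.
    have hlow1 : ∫ y in Set.Iio p ×ˢ Set.univ, vetoSurplus v y.1 y.2 ∂π ≤
        ∫ y in Set.Iio p ×ˢ Set.univ, ω y.2 ∂π := by
      refine setIntegral_mono_on_ae hS_int.integrableOn (h.integrable_snd hω_int).integrableOn
        (measurableSet_Iio.prod .univ) ?_
      filter_upwards [h.nonneg] with y hy hyp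
      have hyp' : y.1 < p := hyp.1
      have := hω y.2 y.1 0 (by rw [sub_zero, abs_of_nonneg hy]; linarith)
      rw [vetoSurplus_zero, sub_zero] at this
      exact (le_abs_self _).trans this
    have e1 : (K.card : ℝ) * η ≤ ε / 8 := by
      have : (K.card : ℝ) * η ≤ n * (1 + W) * η := by
        refine mul_le_mul_of_nonneg_right (hKcard.trans ?_) hη0.le
        exact le_mul_of_one_le_right n.cast_nonneg (by linarith)
      linarith
    have e2 : δ * ∑ k ∈ K, ∫ y in cell k ×ˢ Set.univ, H y.2 ∂π ≤ δ * IH :=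
      mul_le_mul_of_nonneg_left (by linarith) hδ0.le
    have e3 : δ * IH ≤ ε / 8 := by
      have : 0 ≤ δ * (3 * W + 1) := by positivity
      linarith
    have hCm_eq : ∑ k ∈ K, ∫ θ in (m k : Set (Set.Icc lo hi)), vetoSurplus v (act (m k)) θ ∂P =
        ∑ k ∈ K, ∫ θ in C k, vetoSurplus v (act (m k)) θ ∂P :=
      Finset.sum_congr rfl fun k hk => by rw [hm k hk]
    rw [hCm_eq, ← hS_eq, add_sub_add_left_eq_sub, dS, abs_lt]
    have hsum' := abs_le.1 hsum
    constructor <;> linarith [hsum'.1, hsum'.2]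
  · have hpg (y : ℝ × Set.Icc lo hi) : vetoProfit u y.1 y.2 ≤ g y.2 := vetoProfit_le hu hlo y.1 y.2
    have hgsnd := h.integrable_snd hg_int
    have hRle (k : ℕ) : R k ≤ ∫ y in cell k ×ˢ Set.univ, g y.2 ∂π :=
      integral_mono h.integrable.integrableOn hgsnd.integrableOn hpg
    -- Relative to full disclosure, pooling changes profit by `R k` minus full extraction from the
    -- cell. The factor `3` is `2 * δ` from the best-response profit plus `δ` from tilting the
    -- integral of `g`.
    have hterm {k : ℕ} (hk : k ∈ K) :
        |∫ θ in C k, (vetoProfit u (act (m k)) θ - g θ) ∂P -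
          (R k - ∫ y in cell k ×ˢ Set.univ, g y.2 ∂π)| ≤
        3 * δ * ∫ y in cell k ×ˢ Set.univ, g y.2 ∂π + (1 + W) * η := by
      have e1 := (hbest' hk).2
      have e2 := hCg hk
      have e3 := h.abs_integral_tilt_sub_le (A := cell k) (b := p + k * s) (e := p + k * s + Δ)
        hδ0.le hδ1 hg_int hg_int hg0 fun θ => le_rfl
      have e4 := mul_le_mul_of_nonneg_left (hRle k) hδ0.le
      rw [integral_sub (integrable_vetoProfit u _) hg_int.integrableOn, integral_vetoProfit]
      rw [abs_le] at *
      constructor <;> linarith [e1.1, e1.2, e2.1, e2.2, e3.1, e3.2]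
    have hsum := (Finset.abs_sum_le_sum_abs _ K).trans (Finset.sum_le_sum fun k hk => hterm hk)
    rw [Finset.sum_sub_distrib, Finset.sum_sub_distrib, Finset.sum_add_distrib, Finset.sum_const,
      nsmul_eq_mul, ← Finset.mul_sum] at hsum
    have dR := hdecomp h.integrable
    have dg := hdecomp hgsnd
    rw [h.integral_snd hg_int] at dg
    have hlow := h.setIntegral_Iio_le hu hu_cont hlo hp0 hx0
    have hlow0 : 0 ≤ ∫ y in Set.Iio p ×ˢ Set.univ, vetoProfit u y.1 y.2 ∂π :=
      integral_nonneg_of_ae (ae_restrict_of_ae (h.nonneg.mono fun y hy =>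
        vetoProfit_nonneg hu hy y.2))
    have hlow1 : ∫ y in Set.Iio p ×ˢ Set.univ, vetoProfit u y.1 y.2 ∂π ≤
        ∫ y in Set.Iio p ×ˢ Set.univ, g y.2 ∂π :=
      integral_mono h.integrable.integrableOn hgsnd.integrableOn hpg
    have hcells : ∑ k ∈ K, ∫ y in cell k ×ˢ Set.univ, g y.2 ∂π ≤ W := by linarith
    have e1 : (K.card : ℝ) * ((1 + W) * η) ≤ ε / 8 := by
      have : (K.card : ℝ) * ((1 + W) * η) ≤ n * ((1 + W) * η) :=
        mul_le_mul_of_nonneg_right hKcard (by positivity)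
      linarith
    have e2 : 3 * δ * ∑ k ∈ K, ∫ y in cell k ×ˢ Set.univ, g y.2 ∂π ≤ 3 * δ * W :=
      mul_le_mul_of_nonneg_left hcells (by positivity)
    have e3 : 3 * δ * W ≤ ε / 8 := by
      have : 0 ≤ δ * (IH + 1) := by positivity
      linarith
    have hCm_eq : ∑ k ∈ K, ∫ θ in (m k : Set (Set.Icc lo hi)),
        (vetoProfit u (act (m k)) θ - (u (2 * θ) - u 0)) ∂P =
        ∑ k ∈ K, ∫ θ in C k, (vetoProfit u (act (m k)) θ - g θ) ∂P :=
      Finset.sum_congr rfl fun k hk => by rw [hm k hk]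
    rw [hCm_eq, ← hR_eq, dR, abs_lt]
    have hsum' := abs_le.1 hsum
    constructor <;> linarith [hsum'.1, hsum'.2]
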